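/- Let $l>0$, $I=(-l,l)$, $H=L^2(I)$, $V=H_0^1(I)$, and for $T>0$ let $E_T=L^4(0,T;L^4(I))$. Here $H_0^k(I)$ is the closure of $C_0^\infty(I)$ in the norm $\bigl(\sum_{j\le k}\|f^{(j)}\|_{L^2(I)}^2\bigr)^{1/2}$, where $C_0^\infty(I)$ is either of the following two classes (the result is asserted for each of them): the smooth functions with compact support in $I$, or the smooth functions on $[-l,l]$ that vanish at $\pm l$. Let $A u=-u_{xxxx}-u_{xx}-c\,u$ be the self-adjoint operator in $H$ with form domain $H_0^2(I)$, i.e. $u\in D(A)$ and $Au=f\in H$ if and only if $u\in H_0^2(I)$ and $$\int_I f v\,dx=\int_I\bigl(-u_{xx}v_{xx}+u_xv_x-c\,uv\bigr)\,dx\qquad\text{for all } v\in H_0^2(I),$$ and suppose that the real number $c$ is such that $A$ is strictly negative: there is $m>0$ with $\langle Au,u\rangle_H\le -m\|u\|_H^2$ for all $u\in D(A)$. Let $S(t)=e^{tA}$, $t\ge 0$, and let $F:E_T\to E_T$ be the continuous extension of the operator $F_0:C^1([0,T];V)\to E_T$, $$(F_0u)(t)=\int_0^t S(t-s)\bigl[-u(s)\,u_x(s)+c\,u(s)\bigr]\,ds,\qquad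 t\in[0,T].$$ For $u_0\in H$ and $w\in E_T$, a solution on $[0,T]$ with data $(u_0,w)$ is a function $y\in E_T$ with $$y(t)=S(t)u_0+F(y+w)(t),\qquad t\in[0,T].$$ Then solutions depend continuously, in fact locally Lipschitz continuously, on the initial datum $u_0\in H$ and on the forcing $w$ in $E$: for all $T>0$ and $R\in\mathbb R$ there are constants $C>0$ and $\delta>0$, depending only on $l$, $c$, $T$, $R$ (and the choice of the class $C_0^\infty(I)$), such that the following holds for every $\tau\in(0,T]$. Let $y_0$ and $y_1$ be solutions on $[0,\tau]$ with data $(u_0,w_0)$ and $(u_1,w_1)$ in $H\times E_\tau$, and suppose that $\|y_0\|_{E_\tau}\le R$, $\|w_0\|_{E_\tau}\le R$ and $\|u_0-u_1\|_H+\|w_0-w_1\|_{E_\tau}\le\delta$. Then $$\|y_0-y_1\|_{E_\tau}\le C\bigl(\|u_0-u_1\|_H+\|w_0-w_1\|_{E_\tau}\bigr),$$ and, for almost every $t\in(0,\tau)$, $$\|y_0(t)-y_1(t)\|_{L^4(I)}\le C\bigl(t^{-1/16}\,\|u_0-u_1\|_H+\|w_0-w_1\|_{E_\tau}\bigr).$$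 -/

import Mathlib

open MeasureTheory Set Filter Topology
open scoped ENNReal ContDiff

noncomputable section

namespace KS

instance factOneLeFour : Fact ((1 : ℝ≥0∞) ≤ 4) := ⟨by norm_num⟩

/-- Lebesgue measure on the interval `I = (-l, l)`. -/
def muI (l : ℝ) : Measure ℝ := volume.restrict (Ioo (-l) l)

/-- `H = L²(I)`. -/
abbrev H (l : ℝ) : Type := Lp ℝ 2 (muI l)

/-- `L⁴(I)`. -/
abbrev L4 (l : ℝ) : Type := Lp ℝ 4 (muI l)

/-- `E = L⁴(0, T; L⁴(I))`. -/
abbrev E (l T : ℝ) : Type := Lp (L4 l) 4 (volume.restrict (Ioo 0 T))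

/-- The two readings of `C₀^∞(I)`. -/
inductive TestClass
  /-- smooth functions with compact support in the open interval -/
  | compactSupport
  /-- functions smooth up to the end points and vanishing there -/
  | vanishing

/-- `φ` belongs to `C₀^∞(I)` (only the restriction of `φ` to `I` matters). -/
def IsTest (b : TestClass) (l : ℝ) (φ : ℝ → ℝ) : Prop :=
  ContDiff ℝ ∞ φ ∧
    match b with
    | .compactSupport => HasCompactSupport φ ∧ tsupport φ ⊆ Ioo (-l) l
    | .vanishing => φ (-l) = 0 ∧ φ l = 0

/-- `H₀^k(I)`: the closure of `C₀^∞(I)` in the norm `(‖f‖² + ‖f'‖² + ⋯ + ‖f^(k)‖²)^(1/2)`.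
An element is the tuple of the function and its weak derivatives; the `j`-th entry is the `j`-th
derivative. (The set whose span is taken is already a linear subspace.)  For `k = 1` both readings
of `C₀^∞(I)` give the functions of `H¹(I)` that vanish at the end points. For `k = 2`,
`compactSupport` gives the functions of `H²(I)` with `u = u' = 0` at the end points, and `vanishing`
those with `u = 0` there. -/
def H0 (b : TestClass) (l : ℝ) (k : ℕ) : Submodule ℝ (PiLp 2 (fun _ : Fin (k + 1) => H l)) :=
  (Submodule.span ℝ {U : PiLp 2 (fun _ : Fin (k + 1) => H l) | ∃ φ : ℝ → ℝ, IsTest b l φ ∧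
    ∀ j : Fin (k + 1), ⇑(U j) =ᵐ[muI l] iteratedDeriv (j : ℕ) φ}).topologicalClosure

/-- `V = H₀¹(I)`. -/
abbrev V (b : TestClass) (l : ℝ) : Type := H0 b l 1

/-- `u ∈ D(A)` and `A u = f`, for the self-adjoint operator `A u = - u_xxxx - u_xx - c u` in `H`
with form domain `D((-A)^(1/2)) = H₀²(I)`:
`⟨A u, v⟩ = - ∫ u_xx v_xx + ∫ u_x v_x - c ∫ u v` for all `v ∈ H₀²(I)`. -/
def IsA (b : TestClass) (l c : ℝ) (u f : H l) : Prop :=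
  ∃ U ∈ H0 b l 2, U 0 = u ∧ ∀ W ∈ H0 b l 2,
    inner ℝ f (W 0) =
      - inner ℝ (U 2) (W 2) + inner ℝ (U 1) (W 1) - c * inner ℝ (U 0) (W 0)

/-- `A` is strictly negative. -/
def StrictlyNegative (b : TestClass) (l c : ℝ) : Prop :=
  ∃ m : ℝ, 0 < m ∧ ∀ u f : H l, IsA b l c u f → inner ℝ f u ≤ - m * ‖u‖ ^ 2

/-- The eigenspace `{u ∈ D(A) : A u = - μ u}` (a closed linear subspace of `H`, so that neither span
nor closure adds anything). -/
def eigenspace (b : TestClass) (l c μ : ℝ) : Submodule ℝ (H l) :=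
  (Submodule.span ℝ {u : H l | IsA b l c u ((-μ) • u)}).topologicalClosure

instance eigenspaceHasOrthogonalProjection (b : TestClass) (l c μ : ℝ) :
    (eigenspace b l c μ).HasOrthogonalProjection :=
  have : CompleteSpace (eigenspace b l c μ) :=
    (Submodule.isClosed_topologicalClosure _).completeSpace_coe
  Submodule.HasOrthogonalProjection.ofCompleteSpace _

/-- The semigroup `S(t) = e^{tA}` on `H`, `t ≥ 0`, through the spectral expansion
`S(t) u = ∑_μ e^{-μ t} P_μ u` (`A` has compact resolvent), where `P_μ` is the orthogonal projection
onto the eigenspace of `A` for the eigenvalue `-μ`; only eigenvalues contribute to the sum. -/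
def S (b : TestClass) (l c t : ℝ) (u : H l) : H l :=
  ∑' μ : ℝ, Real.exp (-μ * t) • (eigenspace b l c μ).starProjection u

/-- The element of `H` represented by a function (`0` if it is not square integrable on `I`). -/
def toH (l : ℝ) (f : ℝ → ℝ) : H l :=
  open Classical in if h : MemLp f 2 (muI l) then h.toLp f else 0

/-- `z ∈ E` is given by the function `f : (0, T) → H`, i.e. `z(t) = f(t)` for almost every `t`. -/
def Represents (l T : ℝ) (z : E l T) (f : ℝ → H l) : Prop :=
  ∀ᵐ t ∂(volume.restrict (Ioo 0 T)), ⇑(z t) =ᵐ[muI l] ⇑(f t)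

/-- The element of `E` given by a function `f : (0, T) → H` (`0` if there is none). -/
def toE (l T : ℝ) (f : ℝ → H l) : E l T :=
  open Classical in if h : ∃ z : E l T, Represents l T z f then h.choose else 0

/-- `G₀ u = - u u_x + c u` for `u ∈ V` (a square integrable function, as `u` is bounded). -/
def G0 (b : TestClass) (l c : ℝ) (u : V b l) : H l :=
  toH l (fun x => - (u.1 0 x * u.1 1 x) + c * u.1 0 x)

/-- `(F₀ u)(t) = ∫₀ᵗ S(t - s) (G₀ u)(s) ds`, a Bochner integral in `H`, for `u : [0, T] → V`. -/
def F0curve (b : TestClass) (l c : ℝ) (u : ℝ → V b l) (t : ℝ) : H l :=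
  ∫ s in (0 : ℝ)..t, S b l c (t - s) (G0 b l c (u s))

/-- `z ∈ E` is given by the curve `u ∈ C¹([0, T]; V)`. -/
def IsC1Curve (b : TestClass) (l T : ℝ) (z : E l T) (u : ℝ → V b l) : Prop :=
  ContDiffOn ℝ 1 u (Icc 0 T) ∧ Represents l T z (fun t => (u t).1 0)

/-- `C¹([0, T]; V)` as a subset of `E`. -/
def C1V (b : TestClass) (l T : ℝ) : Set (E l T) := {z | ∃ u, IsC1Curve b l T z u}

/-- `F₀ : C¹([0, T]; V) → E` (given the value `0` outside `C¹([0, T]; V)`). -/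
def F0 (b : TestClass) (l c T : ℝ) (z : E l T) : E l T :=
  open Classical in
  if h : ∃ u, IsC1Curve b l T z u then toE l T (F0curve b l c h.choose) else 0

/-- `F : E → E`, the continuous extension of `F₀`:
`F z` is the limit of `F₀ u` as `u ∈ C¹([0, T]; V)` tends to `z` in `E`. -/
def F (b : TestClass) (l c T : ℝ) : E l T → E l T :=
  extendFrom (C1V b l T) (F0 b l c T)

/-- `y ∈ E` solves `y(t) = S(t) u₀ + F(y + w)(t)`, `t ∈ [0, T]`. -/
def IsSolution (b : TestClass) (l c T : ℝ) (u₀ : H l) (w y : E l T) : Prop :=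
  y = toE l T (fun t => S b l c t u₀) + F b l c T (y + w)

end KS

end

/-!
The semigroup smooths: `S(t)` maps `H` to `L⁴(I)` with norm `O(t^{-1/16})`, and maps the derivative
of an `L²` function to `L⁴(I)` with norm `O(t^{-5/16})`. The nonlinearity is
`- u u_x + c u = - ½ (u²)_x + c u`, so with Hölder's inequality the Duhamel integral is locally
Lipschitz from `L⁴(0, t; L⁴(I))` to `L⁴(I)`, uniformly in `t ≤ T`, because `(t - s)^{-5/16}` is
square integrable on `(0, t)` (`exists_norm_duhamel_sub_le`). This estimate is pointwise in `t` and
involves the past of `t` only. It passes to the extension `F` because `C¹([0, T]; V)` is dense in `E`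
(`dense_C1V`, `exists_F_sub_ae_le`). For the difference `d` of two solutions it yields
`‖d(t)‖⁴ ≤ α(t) + β ∫₀ᵗ ‖d‖⁴`, with `∫ α = O(ε⁴)` where `ε` is the distance of the data. As `y₁` is
not assumed to be bounded, this is available only as long as `∫₀ᵗ ‖d‖⁴ ≤ 1`; for small `ε`
Gronwall's inequality keeps the integral below `1`, so that it never leaves this range
(`integral_le_of_le_one_imp`).

The smoothing estimates come from the form of `A`. On `H₀²(I)`, integration by parts gives
`‖u'‖² ≤ ‖u‖ ‖u''‖`; only `u = 0` at the end points is needed, so both readings of `C₀^∞(I)` are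
covered at once. Hence the form is coercive up to a multiple of `‖u‖²`, the elements of the
eigenspaces are weak eigenfunctions (`exists_eigenLift`), different eigenspaces are orthogonal for
`H` and for the form, and strict negativity leaves only eigenvalues `-μ` with `μ > 0`. Bounds on the
multiplier `μ e^{-2μt}` then give `‖(S(t) f)''‖ ≲ t^{-1/2} ‖f‖` (`S_smoothing`), and
`‖v‖₄⁴ ≤ 2 ‖v‖³ ‖v'‖` gives the power `t^{-1/16}`. The derivative in the nonlinearity is moved to the
other factor by self-adjointness of `S(t)` (`exists_norm_S_G0_sub_le`). The argument does not use
completeness of the eigenfunctions.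
-/

noncomputable section

namespace KS

/-! ### Test functions and the spaces `H₀^k(I)` -/

instance muI_isFiniteMeasure (l : ℝ) : IsFiniteMeasure (muI l) := by
  unfold muI; infer_instance

theorem IsTest.eq_zero {b : TestClass} {l : ℝ} {φ : ℝ → ℝ} (h : IsTest b l φ) :
    φ (-l) = 0 ∧ φ l = 0 := by
  obtain ⟨-, h⟩ := h
  cases b with
  | compactSupport =>
    exact ⟨image_eq_zero_of_notMem_tsupport fun hx => by simpa using (h.2 hx).1,
      image_eq_zero_of_notMem_tsupport fun hx => by simpa using (h.2 hx).2⟩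
  | vanishing => exact h

theorem IsTest.add {b : TestClass} {l : ℝ} {φ ψ : ℝ → ℝ} (h : IsTest b l φ) (h' : IsTest b l ψ) :
    IsTest b l (φ + ψ) := by
  refine ⟨h.1.add h'.1, ?_⟩
  obtain ⟨-, h⟩ := h
  obtain ⟨-, h'⟩ := h'
  cases b with
  | compactSupport =>
    exact ⟨h.1.add h'.1, (tsupport_add _ _).trans (union_subset h.2 h'.2)⟩
  | vanishing => simp only at h h' ⊢; simp [h.1, h.2, h'.1, h'.2]

theorem IsTest.const_smul {b : TestClass} {l : ℝ} {φ : ℝ → ℝ} (h : IsTest b l φ) (a : ℝ) :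
    IsTest b l (a • φ) := by
  refine ⟨h.1.const_smul a, ?_⟩
  obtain ⟨-, h⟩ := h
  cases b with
  | compactSupport =>
    have : tsupport (a • φ) ⊆ tsupport φ := closure_mono (Function.support_const_smul_subset _ _)
    exact ⟨h.1.of_isClosed_subset (isClosed_tsupport _) this, this.trans h.2⟩
  | vanishing => simp only at h ⊢; simp [h.1, h.2]

/-- `U` is the tuple `(φ, φ', …, φ^(k))` of a test function. -/
def TestTuple (b : TestClass) (l : ℝ) {k : ℕ} (φ : ℝ → ℝ)
    (U : PiLp 2 (fun _ : Fin (k + 1) => H l)) : Prop :=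
  IsTest b l φ ∧ ∀ j : Fin (k + 1), ⇑(U j) =ᵐ[muI l] iteratedDeriv (j : ℕ) φ

theorem H0_eq_closure (b : TestClass) (l : ℝ) (k : ℕ) :
    (H0 b l k : Set (PiLp 2 (fun _ : Fin (k + 1) => H l))) =
      closure {U | ∃ φ, TestTuple b l φ U} := by
  let M : Submodule ℝ (PiLp 2 (fun _ : Fin (k + 1) => H l)) :=
    { carrier := {U | ∃ φ, TestTuple b l φ U}
      add_mem' := by
        rintro U W ⟨φ, hφ, hU⟩ ⟨ψ, hψ, hW⟩
        refine ⟨φ + ψ, hφ.add hψ, fun j => ?_⟩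
        have e : iteratedDeriv (j : ℕ) (φ + ψ) = iteratedDeriv j φ + iteratedDeriv j ψ := by
          ext x
          exact iteratedDeriv_add (hφ.1.contDiffAt.of_le (by exact_mod_cast le_top))
            (hψ.1.contDiffAt.of_le (by exact_mod_cast le_top))
        rw [e, PiLp.add_apply]
        exact (Lp.coeFn_add _ _).trans ((hU j).add (hW j))
      zero_mem' := by
        refine ⟨(0 : ℝ) • fun _ => 0, ?_, fun j => ?_⟩
        · refine IsTest.const_smul ⟨contDiff_const, ?_⟩ 0
          cases b with
          | compactSupport =>
            have : tsupport (fun _ : ℝ => (0 : ℝ)) = ∅ := by simp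
            exact ⟨HasCompactSupport.zero, by simp [this]⟩
          | vanishing => simp
        · have : iteratedDeriv (j : ℕ) ((0 : ℝ) • fun _ : ℝ => (0 : ℝ)) = 0 := by
            ext x; simp
          rw [this]
          exact Lp.coeFn_zero _ _ _
      smul_mem' := by
        rintro a U ⟨φ, hφ, hU⟩
        refine ⟨a • φ, hφ.const_smul a, fun j => ?_⟩
        have e : iteratedDeriv (j : ℕ) (a • φ) = a • iteratedDeriv j φ := by
          ext x
          exact iteratedDeriv_const_smul_field a φ
        rw [e, PiLp.smul_apply]
        exact (Lp.coeFn_smul _ _).trans ((hU j).const_smul a) }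
  have hM : H0 b l k = M.topologicalClosure := by
    rw [H0]
    congr 1
    exact Submodule.span_eq M
  rw [hM, Submodule.topologicalClosure_coe]
  rfl

/-- Closed conditions on `H₀^k(I)` only have to be checked on test functions. -/
theorem H0_induction {b : TestClass} {l : ℝ} {k : ℕ}
    {P : PiLp 2 (fun _ : Fin (k + 1) => H l) → Prop} (hP : IsClosed {U | P U})
    (h : ∀ φ U, TestTuple b l φ U → P U) {U : PiLp 2 (fun _ : Fin (k + 1) => H l)}
    (hU : U ∈ H0 b l k) : P U := by
  have : U ∈ closure {U | ∃ φ, TestTuple b l φ U} := by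
    rw [← H0_eq_closure]; exact hU
  exact closure_minimal (by rintro U ⟨φ, hφ⟩; exact h φ U hφ) hP this

theorem TestTuple.mem_H0 {b : TestClass} {l : ℝ} {k : ℕ} {φ : ℝ → ℝ}
    {U : PiLp 2 (fun _ : Fin (k + 1) => H l)} (h : TestTuple b l φ U) : U ∈ H0 b l k := by
  have : U ∈ closure {U | ∃ φ, TestTuple b l φ U} := subset_closure ⟨φ, h⟩
  rw [← H0_eq_closure] at this
  exact this

theorem memLp_muI_of_continuous {l : ℝ} {f : ℝ → ℝ} (hf : Continuous f) (p : ℝ≥0∞) :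
    MemLp f p (muI l) := by
  obtain ⟨C, hC⟩ := (isCompact_Icc (a := -l) (b := l)).exists_bound_of_continuousOn hf.continuousOn
  refine MemLp.of_bound hf.aestronglyMeasurable C ?_
  exact (ae_restrict_iff' measurableSet_Ioo).2 (.of_forall fun x hx => hC x (Ioo_subset_Icc_self hx))

theorem iteratedDeriv_continuous {φ : ℝ → ℝ} (h : ContDiff ℝ ∞ φ) (j : ℕ) :
    Continuous (iteratedDeriv j φ) :=
  h.continuous_iteratedDeriv j (by exact_mod_cast le_top)

/-- Every test function defines an element of `H₀^k(I)`. -/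
theorem exists_testTuple {b : TestClass} {l : ℝ} (k : ℕ) {φ : ℝ → ℝ} (h : IsTest b l φ) :
    ∃ U : PiLp 2 (fun _ : Fin (k + 1) => H l), TestTuple b l φ U :=
  ⟨WithLp.toLp 2 fun j =>
    (memLp_muI_of_continuous (iteratedDeriv_continuous h.1 (j : ℕ)) 2).toLp
      (iteratedDeriv (j : ℕ) φ),
    h, fun j => MemLp.coeFn_toLp
      (memLp_muI_of_continuous (iteratedDeriv_continuous h.1 (j : ℕ)) 2)⟩

theorem integral_muI_deriv {l : ℝ} (hl : 0 < l) {f : ℝ → ℝ} (hf : ContDiff ℝ 1 f) :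
    ∫ x, deriv f x ∂(muI l) = f l - f (-l) := by
  rw [muI, ← integral_Ioc_eq_integral_Ioo, ← intervalIntegral.integral_of_le (by linarith)]
  exact intervalIntegral.integral_deriv_eq_sub
    (fun x _ => (hf.differentiable (by simp)) x)
    ((hf.continuous_deriv le_rfl).intervalIntegrable _ _)

theorem inner_H {l : ℝ} (f g : H l) : inner ℝ f g = ∫ x, f x * g x ∂(muI l) := by
  rw [L2.inner_def]
  refine integral_congr_ae (.of_forall fun x => ?_)
  simp [mul_comm]

theorem TestTuple.inner_eq {b : TestClass} {l : ℝ} {k : ℕ} {φ : ℝ → ℝ}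
    {U : PiLp 2 (fun _ : Fin (k + 1) => H l)} (h : TestTuple b l φ U) (i j : Fin (k + 1)) :
    inner ℝ (U i) (U j) = ∫ x, iteratedDeriv i φ x * iteratedDeriv j φ x ∂(muI l) := by
  rw [inner_H]
  refine integral_congr_ae ?_
  filter_upwards [h.2 i, h.2 j] with x h1 h2
  rw [h1, h2]

/-- Integration by parts in `H₀²(I)`; the boundary term vanishes with the function alone. -/
theorem inner_one_one {b : TestClass} {l : ℝ} (hl : 0 < l) {U : PiLp 2 (fun _ : Fin 3 => H l)}
    (hU : U ∈ H0 b l 2) : inner ℝ (U 1) (U 1) = - inner ℝ (U 0) (U 2) := by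
  refine H0_induction (P := fun U => inner ℝ (U 1) (U 1) = - inner ℝ (U 0) (U 2)) ?_ ?_ hU
  · exact isClosed_eq (by fun_prop) (by fun_prop)
  · intro φ U h
    have hc := h.1.1
    have e : deriv (fun x => φ x * deriv φ x) = fun x =>
        deriv φ x * deriv φ x + φ x * deriv (deriv φ) x := by
      ext x
      exact deriv_fun_mul ((hc.differentiable (by simp)) x)
        (((contDiff_infty_iff_deriv.1 hc).2.differentiable (by simp)) x)
    have h1 := integral_muI_deriv hl (f := fun x => φ x * deriv φ x)
      ((hc.mul (contDiff_infty_iff_deriv.1 hc).2).of_le (by exact_mod_cast le_top))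
    rw [e, h.1.eq_zero.1, h.1.eq_zero.2] at h1
    have c1 := iteratedDeriv_continuous hc 1
    have c2 := iteratedDeriv_continuous hc 2
    have c0 := hc.continuous
    rw [h.inner_eq, h.inner_eq, eq_neg_iff_add_eq_zero, ← integral_add]
    · simpa [iteratedDeriv_succ, iteratedDeriv_zero] using h1
    · exact memLp_one_iff_integrable.1 (memLp_muI_of_continuous (c1.mul c1) 1)
    · exact memLp_one_iff_integrable.1
        (memLp_muI_of_continuous (by simpa using! c0.mul c2) 1)

theorem norm_one_sq_le {b : TestClass} {l : ℝ} (hl : 0 < l) {U : PiLp 2 (fun _ : Fin 3 => H l)}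
    (hU : U ∈ H0 b l 2) : ‖U 1‖ ^ 2 ≤ ‖U 0‖ * ‖U 2‖ := by
  have h := inner_one_one hl hU
  rw [real_inner_self_eq_norm_sq] at h
  rw [h]
  have := abs_real_inner_le_norm (U 0) (U 2)
  exact (neg_le_abs _).trans this

/-- `H₀²(I) ⊆ H₀¹(I)`. -/
theorem exists_H0_one {b : TestClass} {l : ℝ} {U : PiLp 2 (fun _ : Fin 3 => H l)}
    (hU : U ∈ H0 b l 2) : ∃ v : V b l, v.1 0 = U 0 ∧ v.1 1 = U 1 := by
  let g : PiLp 2 (fun _ : Fin 3 => H l) → PiLp 2 (fun _ : Fin 2 => H l) :=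
    fun U => WithLp.toLp 2 ![U 0, U 1]
  have hg : Continuous g := by
    refine (PiLp.continuous_toLp 2 _).comp (continuous_pi fun i => ?_)
    fin_cases i
    · exact PiLp.continuous_apply 2 _ 0
    · exact PiLp.continuous_apply 2 _ 1
  have : g U ∈ H0 b l 1 := by
    refine H0_induction (P := fun U => g U ∈ H0 b l 1) ?_ ?_ hU
    · exact (Submodule.isClosed_topologicalClosure _).preimage hg
    · intro φ U h
      refine TestTuple.mem_H0 (φ := φ) ⟨h.1, fun j => ?_⟩
      fin_cases j
      · exact h.2 0
      · exact h.2 1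
  exact ⟨⟨g U, this⟩, rfl, rfl⟩

theorem TestTuple.sq_le {b : TestClass} {l : ℝ} {φ : ℝ → ℝ}
    {U : PiLp 2 (fun _ : Fin 2 => H l)} (h : TestTuple b l φ U) {x : ℝ} (hx : x ∈ Ioo (-l) l) :
    φ x ^ 2 ≤ 2 * (‖U 0‖ * ‖U 1‖) := by
  have hc := h.1.1
  have c0 := hc.continuous
  have c1 : Continuous (deriv φ) := (contDiff_infty_iff_deriv.1 hc).2.continuous
  have hint : Integrable (fun x => 2 * (|φ x| * |deriv φ x|)) (muI l) :=
    memLp_one_iff_integrable.1 (memLp_muI_of_continuous (by fun_prop) 1)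
  have h1 : φ x ^ 2 = ∫ t in (-l)..x, 2 * (φ t * deriv φ t) := by
    have := intervalIntegral.integral_eq_sub_of_hasDerivAt (a := -l) (b := x)
      (f := fun t => φ t ^ 2) (f' := fun t => 2 * (φ t * deriv φ t))
      (fun t _ => by
        have := ((hc.differentiable (by simp)) t).hasDerivAt.pow 2
        refine this.congr_deriv ?_
        simp; ring)
      (Continuous.intervalIntegrable (by fun_prop) _ _)
    rw [this, h.1.eq_zero.1]; ring
  have h2 : (∫ t in (-l)..x, 2 * (φ t * deriv φ t)) ≤ ∫ t, 2 * (|φ t| * |deriv φ t|) ∂(muI l) := by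
    rw [intervalIntegral.integral_of_le hx.1.le]
    have hle := fun t => (le_abs_self (2 * (φ t * deriv φ t))).trans_eq (by
      rw [abs_mul, abs_mul, abs_two] : _ = 2 * (|φ t| * |deriv φ t|))
    refine (integral_mono (Continuous.integrableOn_Ioc (by fun_prop))
      (Continuous.integrableOn_Ioc (by fun_prop)) hle).trans ?_
    refine setIntegral_mono_set (by exact hint) (.of_forall fun t => by positivity) ?_
    exact Eventually.of_forall (Ioc_subset_Ioo_right hx.2)
  have h3 : ∫ t, 2 * (|φ t| * |deriv φ t|) ∂(muI l) = 2 * inner ℝ |U 0| |U 1| := by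
    rw [integral_const_mul, inner_H]
    congr 1
    refine integral_congr_ae ?_
    filter_upwards [h.2 0, h.2 1, Lp.coeFn_abs (U 0), Lp.coeFn_abs (U 1)] with t a0 a1 a2 a3
    rw [a2, a3, a0, a1]
    simp [iteratedDeriv_one]
  rw [h1]
  refine (h2.trans_eq h3).trans ?_
  have := real_inner_le_norm |U 0| |U 1|
  rw [norm_abs_eq_norm, norm_abs_eq_norm] at this
  linarith

/-- The one-dimensional Agmon inequality. -/
theorem ae_sq_le {b : TestClass} {l : ℝ} (u : V b l) :
    ∀ᵐ x ∂(muI l), (u.1 0 x) ^ 2 ≤ 2 * (‖u.1 0‖ * ‖u.1 1‖) := by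
  have hu : u.1 ∈ closure {U | ∃ φ, TestTuple b l φ U} := by
    rw [← H0_eq_closure]; exact u.2
  obtain ⟨W, hW, hlim⟩ := mem_closure_iff_seq_limit.1 hu
  have h0 : Tendsto (fun n => W n 0) atTop (𝓝 (u.1 0)) :=
    ((PiLp.continuous_apply 2 _ 0).tendsto _).comp hlim
  have h1 : Tendsto (fun n => W n 1) atTop (𝓝 (u.1 1)) :=
    ((PiLp.continuous_apply 2 _ 1).tendsto _).comp hlim
  obtain ⟨ns, hns, hae⟩ := (tendstoInMeasure_of_tendsto_Lp h0).exists_seq_tendsto_ae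
  have hb : ∀ᵐ x ∂(muI l), ∀ n, (W n 0 x) ^ 2 ≤ 2 * (‖W n 0‖ * ‖W n 1‖) := by
    rw [ae_all_iff]
    intro n
    obtain ⟨φ, hφ⟩ := hW n
    filter_upwards [hφ.2 0, ae_restrict_mem measurableSet_Ioo] with x hx hxI
    rw [hx]
    simpa using hφ.sq_le hxI
  filter_upwards [hae, hb] with x hx hbx
  refine le_of_tendsto_of_tendsto' (hx.pow 2)
    (((h0.norm.mul h1.norm).const_mul 2).comp hns.tendsto_atTop) fun n => hbx (ns n)

theorem V_norm_sq {b : TestClass} {l : ℝ} (u : V b l) :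
    ‖u‖ ^ 2 = ‖u.1 0‖ ^ 2 + ‖u.1 1‖ ^ 2 := by
  change ‖u.1‖ ^ 2 = _
  rw [PiLp.norm_sq_eq_of_L2, Fin.sum_univ_two]

theorem ae_abs_le {b : TestClass} {l : ℝ} (u : V b l) :
    ∀ᵐ x ∂(muI l), |u.1 0 x| ≤ ‖u‖ := by
  filter_upwards [ae_sq_le u] with x hx
  refine abs_le_of_sq_le_sq (hx.trans ?_) (norm_nonneg _)
  rw [V_norm_sq]
  nlinarith [sq_nonneg (‖u.1 0‖ - ‖u.1 1‖)]

/-! ### Products and the embedding into `L⁴(I)` -/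

theorem norm_pow_four {α F : Type*} [MeasurableSpace α] [NormedAddCommGroup F] {μ : Measure α}
    (z : Lp F 4 μ) : ‖z‖ ^ 4 = ∫ t, ‖z t‖ ^ 4 ∂μ := by
  have h := (Lp.memLp z).eLpNorm_eq_integral_rpow_norm (by norm_num) (by norm_num)
  have h4 : (4 : ℝ≥0∞).toReal = (4 : ℕ) := by norm_num
  have h0 : 0 ≤ ∫ t, ‖z t‖ ^ 4 ∂μ := integral_nonneg fun t => by positivity
  rw [Lp.norm_def, h, h4]
  simp only [Real.rpow_natCast]
  rw [ENNReal.toReal_ofReal (by positivity), ← Real.rpow_natCast, ← Real.rpow_mul h0]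
  norm_num

theorem integrable_norm_pow_four {α F : Type*} [MeasurableSpace α] [NormedAddCommGroup F]
    {μ : Measure α} (z : Lp F 4 μ) : Integrable (fun t => ‖z t‖ ^ 4) μ := by
  have := (Lp.memLp z).integrable_norm_pow (p := 4) (by norm_num)
  exact this

instance holderTriple_four_four_two : ENNReal.HolderTriple 4 4 2 := ⟨by
  rw [← two_mul, show (4 : ℝ≥0∞) = 2 * 2 by norm_num,
    ENNReal.mul_inv (by norm_num) (by norm_num), ← mul_assoc,
    ENNReal.mul_inv_cancel (by norm_num) (by norm_num), one_mul]⟩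

theorem memLp_mul_H {b : TestClass} {l : ℝ} (u : V b l) (h : H l) :
    MemLp (fun x => u.1 0 x * h x) 2 (muI l) := by
  refine MemLp.of_le_mul (Lp.memLp h)
    ((Lp.aestronglyMeasurable _).mul (Lp.aestronglyMeasurable _)) (c := ‖u‖) ?_
  filter_upwards [ae_abs_le u] with x hx
  rw [norm_mul]
  exact mul_le_mul_of_nonneg_right hx (norm_nonneg _)

/-- Multiplication `(u, h) ↦ u h` as a bounded bilinear map `V × H → H`. -/
def mulV (b : TestClass) (l : ℝ) : V b l →L[ℝ] H l →L[ℝ] H l :=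
  LinearMap.mkContinuous₂
    (LinearMap.mk₂ ℝ (fun u h => (memLp_mul_H u h).toLp _)
      (fun u v h => by
        rw [← MemLp.toLp_add]
        refine (MemLp.toLp_eq_toLp_iff _ _).2 ?_
        filter_upwards [Lp.coeFn_add (u.1 0) (v.1 0)] with x hx
        change (u.1 0 + v.1 0 : H l) x * h x = u.1 0 x * h x + v.1 0 x * h x
        rw [hx, Pi.add_apply]; ring)
      (fun a u h => by
        rw [← MemLp.toLp_const_smul]
        refine (MemLp.toLp_eq_toLp_iff _ _).2 ?_
        filter_upwards [Lp.coeFn_smul a (u.1 0)] with x hx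
        change (a • u.1 0 : H l) x * h x = a • (u.1 0 x * h x)
        rw [hx, Pi.smul_apply]; simp [mul_assoc])
      (fun u h k => by
        rw [← MemLp.toLp_add]
        refine (MemLp.toLp_eq_toLp_iff _ _).2 ?_
        filter_upwards [Lp.coeFn_add h k] with x hx
        rw [hx, Pi.add_apply, Pi.add_apply]; ring)
      (fun a u h => by
        rw [← MemLp.toLp_const_smul]
        refine (MemLp.toLp_eq_toLp_iff _ _).2 ?_
        filter_upwards [Lp.coeFn_smul a h] with x hx
        rw [hx, Pi.smul_apply, Pi.smul_apply]; simp [mul_left_comm])) 1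
    (fun u h => by
      rw [one_mul]
      refine Lp.norm_le_mul_norm_of_ae_le_mul ?_
      filter_upwards [ae_abs_le u, (memLp_mul_H u h).coeFn_toLp] with x hx h2
      rw [LinearMap.mk₂_apply, h2, norm_mul]
      exact mul_le_mul_of_nonneg_right hx (norm_nonneg _))

theorem mulV_coe {b : TestClass} {l : ℝ} (u : V b l) (h : H l) :
    ⇑(mulV b l u h) =ᵐ[muI l] fun x => u.1 0 x * h x :=
  (memLp_mul_H u h).coeFn_toLp

theorem continuous_V_apply {b : TestClass} {l : ℝ} (j : Fin 2) :
    Continuous fun u : V b l => u.1 j :=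
  (PiLp.continuous_apply 2 _ j).comp continuous_subtype_val

theorem G0_eq {b : TestClass} {l : ℝ} (c : ℝ) (u : V b l) :
    G0 b l c u = - mulV b l u (u.1 1) + c • u.1 0 := by
  have hae : ⇑(- mulV b l u (u.1 1) + c • u.1 0) =ᵐ[muI l]
      fun x => - (u.1 0 x * u.1 1 x) + c * u.1 0 x := by
    filter_upwards [Lp.coeFn_add (- mulV b l u (u.1 1)) (c • u.1 0),
      Lp.coeFn_neg (mulV b l u (u.1 1)), Lp.coeFn_smul c (u.1 0), mulV_coe u (u.1 1)]
      with x h1 h2 h3 h4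
    rw [h1, Pi.add_apply, h2, h3, Pi.neg_apply, h4, Pi.smul_apply, smul_eq_mul]
  have hm := (memLp_congr_ae hae).1 (Lp.memLp _)
  rw [G0, toH, dif_pos hm]
  refine Lp.ext ?_
  exact hm.coeFn_toLp.trans hae.symm

theorem continuous_G0 (b : TestClass) (l c : ℝ) : Continuous (G0 b l c) := by
  have : G0 b l c = fun u => - mulV b l u (u.1 1) + c • u.1 0 := funext fun u => G0_eq c u
  rw [this]
  have h0 := continuous_V_apply (b := b) (l := l) 0
  have h1 := continuous_V_apply (b := b) (l := l) 1
  have : Continuous fun u : V b l => mulV b l u (u.1 1) := (mulV b l).continuous.clm_apply h1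
  fun_prop

theorem dense_testTuple (b : TestClass) (l : ℝ) :
    Dense {u : V b l | ∃ φ, TestTuple b l φ u.1} := by
  intro u
  have hu : u.1 ∈ closure {U | ∃ φ, TestTuple b l φ U} := by
    rw [← H0_eq_closure]; exact u.2
  rw [closure_subtype]
  refine closure_mono ?_ hu
  rintro U ⟨φ, hφ⟩
  exact ⟨⟨U, hφ.mem_H0⟩, ⟨φ, hφ⟩, rfl⟩

/-- `∫ u u_x w = - ½ ∫ u² w_x`: the weak form of `u u_x = ½ (u²)_x`. -/
theorem inner_mulV_deriv {b : TestClass} {l : ℝ} (hl : 0 < l) (u w : V b l) :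
    inner ℝ (mulV b l u (u.1 1)) (w.1 0) = - (1 / 2) * inner ℝ (mulV b l u (u.1 0)) (w.1 1) := by
  have h0 := continuous_V_apply (b := b) (l := l) 0
  have h1 := continuous_V_apply (b := b) (l := l) 1
  have c1 : Continuous fun u : V b l => mulV b l u (u.1 1) := (mulV b l).continuous.clm_apply h1
  have c0 : Continuous fun u : V b l => mulV b l u (u.1 0) := (mulV b l).continuous.clm_apply h0
  -- Both sides are continuous on `V × V`, so that test functions `φ`, `ψ` suffice; there the identity
  -- is `∫ (φ² ψ)' = 0`.
  have hcl : IsClosed {p : V b l × V b l | inner ℝ (mulV b l p.1 (p.1.1 1)) (p.2.1 0) =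
      - (1 / 2) * inner ℝ (mulV b l p.1 (p.1.1 0)) (p.2.1 1)} :=
    isClosed_eq ((c1.comp continuous_fst).inner (h0.comp continuous_snd))
      (continuous_const.mul ((c0.comp continuous_fst).inner (h1.comp continuous_snd)))
  have hd := (dense_testTuple b l).prod (dense_testTuple b l)
  have : (u, w) ∈ closure ({u : V b l | ∃ φ, TestTuple b l φ u.1} ×ˢ
      {u : V b l | ∃ φ, TestTuple b l φ u.1}) := hd _
  refine closure_minimal ?_ hcl this
  rintro ⟨u, w⟩ ⟨⟨φ, hφ⟩, ⟨ψ, hψ⟩⟩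
  change inner ℝ (mulV b l u (u.1 1)) (w.1 0) = - (1 / 2) * inner ℝ (mulV b l u (u.1 0)) (w.1 1)
  have eq1 : inner ℝ (mulV b l u (u.1 1)) (w.1 0) = ∫ x, φ x * deriv φ x * ψ x ∂(muI l) := by
    rw [inner_H]
    refine integral_congr_ae ?_
    filter_upwards [mulV_coe u (u.1 1), hφ.2 0, hφ.2 1, hψ.2 0] with x a1 a2 a3 a4
    rw [a1, a2, a3, a4]
    simp [iteratedDeriv_one]
  have eq2 : inner ℝ (mulV b l u (u.1 0)) (w.1 1) = ∫ x, φ x * φ x * deriv ψ x ∂(muI l) := by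
    rw [inner_H]
    refine integral_congr_ae ?_
    filter_upwards [mulV_coe u (u.1 0), hφ.2 0, hψ.2 1] with x a1 a2 a4
    rw [a1, a2, a4]
    simp [iteratedDeriv_one]
  have cφ := hφ.1.1
  have cψ := hψ.1.1
  have c1 : Continuous (deriv φ) := (contDiff_infty_iff_deriv.1 cφ).2.continuous
  have c2 : Continuous (deriv ψ) := (contDiff_infty_iff_deriv.1 cψ).2.continuous
  have c3 := cφ.continuous
  have c4 := cψ.continuous
  have e : deriv (fun x => φ x * φ x * ψ x) = fun x =>
      2 * (φ x * deriv φ x * ψ x) + φ x * φ x * deriv ψ x := by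
    ext x
    have d1 := ((cφ.differentiable (by simp)) x).hasDerivAt
    have d2 := ((cψ.differentiable (by simp)) x).hasDerivAt
    rw [((d1.fun_mul d1).fun_mul d2).deriv]
    ring
  have h1 := integral_muI_deriv hl (f := fun x => φ x * φ x * ψ x)
    (((cφ.mul cφ).mul cψ).of_le (by exact_mod_cast le_top))
  have i1 : Integrable (fun x => φ x * deriv φ x * ψ x) (muI l) :=
    memLp_one_iff_integrable.1 (memLp_muI_of_continuous (by fun_prop) 1)
  have i2 : Integrable (fun x => φ x * φ x * deriv ψ x) (muI l) :=
    memLp_one_iff_integrable.1 (memLp_muI_of_continuous (by fun_prop) 1)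
  rw [e, integral_add (i1.const_mul 2) i2, integral_const_mul, hφ.1.eq_zero.1,
    hφ.1.eq_zero.2] at h1
  rw [eq1, eq2]
  linarith

theorem memLp_four {b : TestClass} {l : ℝ} (u : V b l) : MemLp (u.1 0) 4 (muI l) :=
  MemLp.of_bound (Lp.aestronglyMeasurable _) ‖u‖ (ae_abs_le u)

theorem norm_toLp_four_le {b : TestClass} {l : ℝ} (u : V b l) :
    ‖(memLp_four u).toLp _‖ ^ 4 ≤ 2 * (‖u.1 0‖ ^ 3 * ‖u.1 1‖) := by
  have hsq : ‖u.1 0‖ ^ 2 = ∫ x, u.1 0 x * u.1 0 x ∂(muI l) := by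
    rw [← inner_H, real_inner_self_eq_norm_sq]
  have hi : Integrable (fun x => u.1 0 x * u.1 0 x) (muI l) :=
    (Lp.memLp (u.1 0)).integrable_mul (Lp.memLp (u.1 0))
  rw [norm_pow_four]
  calc ∫ x, ‖(memLp_four u).toLp _ x‖ ^ 4 ∂(muI l)
      ≤ ∫ x, 2 * (‖u.1 0‖ * ‖u.1 1‖) * (u.1 0 x * u.1 0 x) ∂(muI l) := by
        refine integral_mono_ae (integrable_norm_pow_four _) (hi.const_mul _) ?_
        filter_upwards [ae_sq_le u, (memLp_four u).coeFn_toLp] with x h1 h2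
        simp only [h2, Real.norm_eq_abs]
        have : |u.1 0 x| ^ 4 = u.1 0 x ^ 2 * (u.1 0 x * u.1 0 x) := by
          rw [show (4 : ℕ) = 2 * 2 from rfl, pow_mul, sq_abs]; ring
        rw [this]
        exact mul_le_mul_of_nonneg_right h1 (mul_self_nonneg _)
    _ = 2 * (‖u.1 0‖ ^ 3 * ‖u.1 1‖) := by
        rw [integral_const_mul, ← hsq]; ring

/-- The embedding `V → L⁴(I)`. -/
def embV (b : TestClass) (l : ℝ) : V b l →L[ℝ] L4 l :=
  LinearMap.mkContinuous
    { toFun := fun u => (memLp_four u).toLp _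
      map_add' := fun u v => by
        rw [← MemLp.toLp_add]
        exact (MemLp.toLp_eq_toLp_iff _ _).2 (Lp.coeFn_add (u.1 0) (v.1 0))
      map_smul' := fun a u => by
        rw [RingHom.id_apply, ← MemLp.toLp_const_smul]
        exact (MemLp.toLp_eq_toLp_iff _ _).2 (Lp.coeFn_smul a (u.1 0)) } 2
    (fun u => by
      refine le_of_pow_le_pow_left₀ (n := 4) (by norm_num) (by positivity) ?_
      refine (norm_toLp_four_le u).trans ?_
      have h := V_norm_sq u
      have h0 : ‖u.1 0‖ ≤ ‖u‖ := abs_le_of_sq_le_sq' (by nlinarith) (norm_nonneg _) |>.2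
      have h1 : ‖u.1 1‖ ≤ ‖u‖ := abs_le_of_sq_le_sq' (by nlinarith) (norm_nonneg _) |>.2
      calc 2 * (‖u.1 0‖ ^ 3 * ‖u.1 1‖) ≤ 2 * (‖u‖ ^ 3 * ‖u‖) := by gcongr
        _ ≤ (2 * ‖u‖) ^ 4 := by
          have : 0 ≤ ‖u‖ ^ 4 := by positivity
          nlinarith)

theorem embV_coe {b : TestClass} {l : ℝ} (u : V b l) : ⇑(embV b l u) =ᵐ[muI l] u.1 0 :=
  (memLp_four u).coeFn_toLp

theorem norm_embV_pow_le {b : TestClass} {l : ℝ} (u : V b l) :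
    ‖embV b l u‖ ^ 4 ≤ 2 * (‖u.1 0‖ ^ 3 * ‖u.1 1‖) := norm_toLp_four_le u

/-- The embedding `L⁴(I) → H`. -/
theorem exists_embH (l : ℝ) : ∃ ι : L4 l →L[ℝ] H l, ∀ f, ⇑(ι f) =ᵐ[muI l] f := by
  have hm : ∀ f : L4 l, MemLp f 2 (muI l) := fun f =>
    (Lp.memLp f).mono_exponent (by norm_num)
  let K : ℝ := ((muI l univ) ^ (1 / (2 : ℝ≥0∞).toReal - 1 / (4 : ℝ≥0∞).toReal)).toReal
  refine ⟨LinearMap.mkContinuous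
    { toFun := fun f => (hm f).toLp _
      map_add' := fun u v => by
        rw [← MemLp.toLp_add]
        exact (MemLp.toLp_eq_toLp_iff _ _).2 (Lp.coeFn_add u v)
      map_smul' := fun a u => by
        rw [RingHom.id_apply, ← MemLp.toLp_const_smul]
        exact (MemLp.toLp_eq_toLp_iff _ _).2 (Lp.coeFn_smul a u) } K (fun f => ?_),
    fun f => (hm f).coeFn_toLp⟩
  change ‖(hm f).toLp _‖ ≤ _
  rw [Lp.norm_toLp, Lp.norm_def, mul_comm, ← ENNReal.toReal_mul]
  refine ENNReal.toReal_mono (ENNReal.mul_ne_top (Lp.eLpNorm_ne_top f) ?_)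
    (eLpNorm_le_eLpNorm_mul_rpow_measure_univ (by norm_num) (Lp.aestronglyMeasurable f))
  exact ENNReal.rpow_ne_top_of_nonneg (by norm_num) (measure_ne_top _ _)

theorem norm_sq_sub_sq_le {b : TestClass} {l : ℝ} (u v : V b l) :
    ‖mulV b l u (u.1 0) - mulV b l v (v.1 0)‖ ≤
      ‖embV b l u - embV b l v‖ * ‖embV b l u + embV b l v‖ := by
  rw [Lp.norm_def, Lp.norm_def, Lp.norm_def, ← ENNReal.toReal_mul]
  refine ENNReal.toReal_mono
    (ENNReal.mul_ne_top (Lp.eLpNorm_ne_top _) (Lp.eLpNorm_ne_top _)) ?_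
  refine le_trans (le_of_eq (eLpNorm_congr_ae ?_)) (eLpNorm_smul_le_mul_eLpNorm
    (p := 4) (q := 4) (r := 2) (Lp.aestronglyMeasurable (embV b l u + embV b l v))
      (Lp.aestronglyMeasurable (embV b l u - embV b l v)))
  filter_upwards [Lp.coeFn_sub (mulV b l u (u.1 0)) (mulV b l v (v.1 0)), mulV_coe u (u.1 0),
    mulV_coe v (v.1 0), Lp.coeFn_sub (embV b l u) (embV b l v),
    Lp.coeFn_add (embV b l u) (embV b l v), embV_coe u, embV_coe v] with x h1 h2 h3 h4 h5 h6 h7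
  rw [h1, Pi.sub_apply, h2, h3, Pi.smul_apply', h4, h5, Pi.sub_apply, Pi.add_apply, h6, h7,
    smul_eq_mul]
  ring

/-! ### Eigenspaces and the spectral calculus -/

/-- The form `⟨U₂, W₂⟩ - ⟨U₁, W₁⟩ + c ⟨U₀, W₀⟩` of `-A`, as a functional of `U`. -/
def form (l c : ℝ) (W : PiLp 2 (fun _ : Fin 3 => H l)) :
    PiLp 2 (fun _ : Fin 3 => H l) →L[ℝ] ℝ :=
  (innerSL ℝ (W 2)).comp (PiLp.proj 2 _ 2) - (innerSL ℝ (W 1)).comp (PiLp.proj 2 _ 1)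
    + c • (innerSL ℝ (W 0)).comp (PiLp.proj 2 _ 0)

theorem form_apply {l : ℝ} (c : ℝ) (U W : PiLp 2 (fun _ : Fin 3 => H l)) :
    form l c W U = inner ℝ (U 2) (W 2) - inner ℝ (U 1) (W 1) + c * inner ℝ (U 0) (W 0) := by
  simp [form, real_inner_comm]

theorem form_comm {l : ℝ} (c : ℝ) (U W : PiLp 2 (fun _ : Fin 3 => H l)) :
    form l c W U = form l c U W := by
  simp only [form_apply, real_inner_comm]

/-- Coercivity of the form, modulo the norm of `H`: the highest derivative. -/
theorem norm_two_sq_le {b : TestClass} {l : ℝ} (hl : 0 < l) (c : ℝ)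
    {U : PiLp 2 (fun _ : Fin 3 => H l)} (hU : U ∈ H0 b l 2) :
    ‖U 2‖ ^ 2 ≤ 2 * form l c U U + (1 + 2 * |c|) * ‖U 0‖ ^ 2 := by
  have h1 := norm_one_sq_le hl hU
  rw [form_apply, real_inner_self_eq_norm_sq, real_inner_self_eq_norm_sq,
    real_inner_self_eq_norm_sq]
  have h2 : -|c| * ‖U 0‖ ^ 2 ≤ c * ‖U 0‖ ^ 2 :=
    mul_le_mul_of_nonneg_right (neg_abs_le c) (by positivity)
  nlinarith [sq_nonneg (‖U 0‖ - ‖U 2‖)]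

/-- Coercivity of the form, modulo the norm of `H`: the full norm. -/
theorem norm_sq_le_form {b : TestClass} {l : ℝ} (hl : 0 < l) (c : ℝ)
    {U : PiLp 2 (fun _ : Fin 3 => H l)} (hU : U ∈ H0 b l 2) :
    ‖U‖ ^ 2 ≤ 3 * form l c U U + (3 + 3 * |c|) * ‖U 0‖ ^ 2 := by
  have h1 := norm_one_sq_le hl hU
  have h2 := norm_two_sq_le hl c hU
  rw [PiLp.norm_sq_eq_of_L2, Fin.sum_univ_three]
  nlinarith [sq_nonneg (‖U 0‖ - ‖U 2‖)]

/-- The elements of `H₀²(I)` that satisfy the weak eigenvalue equation `A U = - μ U`. -/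
def eigenLift (b : TestClass) (l c μ : ℝ) : Submodule ℝ (PiLp 2 (fun _ : Fin 3 => H l)) where
  carrier := {U | U ∈ H0 b l 2 ∧ ∀ W ∈ H0 b l 2, form l c W U = μ * inner ℝ (U 0) (W 0)}
  add_mem' := by
    rintro U U' ⟨h, hU⟩ ⟨h', hU'⟩
    refine ⟨add_mem h h', fun W hW => ?_⟩
    rw [map_add, hU W hW, hU' W hW, PiLp.add_apply, inner_add_left]
    ring
  zero_mem' := ⟨zero_mem _, fun W _ => by simp⟩
  smul_mem' := by
    rintro a U ⟨h, hU⟩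
    refine ⟨Submodule.smul_mem _ _ h, fun W hW => ?_⟩
    rw [map_smul, hU W hW, PiLp.smul_apply, inner_smul_left]
    simp
    ring

theorem isClosed_eigenLift (b : TestClass) (l c μ : ℝ) :
    IsClosed (eigenLift b l c μ : Set (PiLp 2 (fun _ : Fin 3 => H l))) := by
  have : (eigenLift b l c μ : Set (PiLp 2 (fun _ : Fin 3 => H l))) =
      (H0 b l 2 : Set _) ∩ ⋂ W ∈ H0 b l 2, {U | form l c W U = μ * inner ℝ (U 0) (W 0)} := by
    ext U
    simp [eigenLift]
  rw [this]
  refine (Submodule.isClosed_topologicalClosure _).inter (isClosed_biInter fun W _ => ?_)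
  exact isClosed_eq (form l c W).continuous (by fun_prop)

/-- The set of eigenfunctions is closed, by coercivity of the form, so that every element of the
eigenspace satisfies the weak eigenvalue equation. -/
theorem exists_eigenLift {b : TestClass} {l c μ : ℝ} (hl : 0 < l) {u : H l}
    (hu : u ∈ eigenspace b l c μ) : ∃ U ∈ eigenLift b l c μ, U 0 = u := by
  let L := eigenLift b l c μ
  have : CompleteSpace L := (isClosed_eigenLift b l c μ).completeSpace_coe
  let p : L →L[ℝ] H l := (PiLp.proj 2 (fun _ : Fin 3 => H l) 0).comp L.subtypeL
  have hp : ∀ U : L, p U = U.1 0 := fun U => rfl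
  let K : ℝ := 3 * |μ| + (3 + 3 * |c|)
  have hK : 0 ≤ K := by positivity
  have hb : ∀ U : L, ‖U‖ ≤ (Real.sqrt K).toNNReal * ‖p U‖ := by
    intro U
    rw [Real.coe_toNNReal _ (Real.sqrt_nonneg _)]
    have h := norm_sq_le_form hl c U.2.1
    rw [U.2.2 U.1 U.2.1, real_inner_self_eq_norm_sq] at h
    refine abs_le_of_sq_le_sq' ?_ (by positivity) |>.2
    rw [mul_pow, Real.sq_sqrt hK, hp]
    change ‖U.1‖ ^ 2 ≤ _
    have := mul_le_mul_of_nonneg_right (le_abs_self μ) (sq_nonneg ‖U.1 0‖)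
    simp only [K]
    nlinarith
  have hcl : IsClosed (Set.range p) :=
    (AddMonoidHomClass.antilipschitz_of_bound p hb).isClosed_range p.uniformContinuous
  -- By `hb` and completeness, the eigenfunctions already form a closed subspace.
  have hle : eigenspace b l c μ ≤ LinearMap.range p.toLinearMap := by
    refine Submodule.topologicalClosure_minimal _ (Submodule.span_le.2 ?_) hcl
    rintro u ⟨U, hU, rfl, h⟩
    refine ⟨⟨U, hU, fun W hW => ?_⟩, rfl⟩
    have := h W hW
    rw [inner_smul_left] at this
    simp only [conj_trivial] at this
    rw [form_apply]
    linarith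
  obtain ⟨U, rfl⟩ := hle hu
  exact ⟨U.1, U.2, rfl⟩

theorem eigenspace_inner_eq_zero {b : TestClass} {l c μ ν : ℝ} (hl : 0 < l) (h : μ ≠ ν) {u v : H l}
    (hu : u ∈ eigenspace b l c μ) (hv : v ∈ eigenspace b l c ν) : inner ℝ u v = 0 := by
  obtain ⟨U, hU, rfl⟩ := exists_eigenLift hl hu
  obtain ⟨W, hW, rfl⟩ := exists_eigenLift hl hv
  have h1 := hU.2 W hW.1
  have h2 := hW.2 U hU.1
  rw [form_comm, h1, real_inner_comm (U 0) (W 0), ← sub_eq_zero, ← sub_mul] at h2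
  exact (mul_eq_zero.1 h2).resolve_left (sub_ne_zero.2 h)

theorem eigenspace_eq_zero {b : TestClass} {l c μ : ℝ} (hl : 0 < l) (hc : StrictlyNegative b l c)
    (hμ : μ ≤ 0) {u : H l} (hu : u ∈ eigenspace b l c μ) : u = 0 := by
  obtain ⟨m, hm, h⟩ := hc
  obtain ⟨U, hU, rfl⟩ := exists_eigenLift hl hu
  have hA : IsA b l c (U 0) ((-μ) • U 0) := by
    refine ⟨U, hU.1, rfl, fun W hW => ?_⟩
    have := hU.2 W hW
    rw [form_apply] at this
    rw [inner_smul_left]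
    simp only [conj_trivial]
    linarith
  have h1 := h _ _ hA
  rw [inner_smul_left, real_inner_self_eq_norm_sq] at h1
  simp only [conj_trivial] at h1
  have h2 : ‖U 0‖ ^ 2 = 0 := by
    have := mul_nonneg (neg_nonneg.2 hμ) (sq_nonneg ‖U 0‖)
    have h3 := sq_nonneg ‖U 0‖
    by_contra hne
    have h4 : 0 < ‖U 0‖ ^ 2 := lt_of_le_of_ne h3 (Ne.symm hne)
    nlinarith
  simpa using h2

/-- The orthogonal projection onto the eigenspace of `A` for the eigenvalue `-μ`. -/
def proj (b : TestClass) (l c μ : ℝ) : H l →L[ℝ] H l := (eigenspace b l c μ).starProjection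

theorem proj_mem {b : TestClass} {l c μ : ℝ} (f : H l) : proj b l c μ f ∈ eigenspace b l c μ :=
  Submodule.starProjection_apply_mem _ _

theorem inner_proj_left {b : TestClass} {l c μ : ℝ} (f g : H l) :
    inner ℝ (proj b l c μ f) g = inner ℝ f (proj b l c μ g) :=
  Submodule.inner_starProjection_left_eq_right _ _ _

theorem proj_proj_self {b : TestClass} {l c μ : ℝ} (f : H l) :
    proj b l c μ (proj b l c μ f) = proj b l c μ f :=
  Submodule.starProjection_eq_self_iff.2 (proj_mem f)

theorem proj_proj_ne {b : TestClass} {l c μ ν : ℝ} (hl : 0 < l) (h : μ ≠ ν) (f : H l) :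
    proj b l c μ (proj b l c ν f) = 0 :=
  (Submodule.starProjection_apply_eq_zero_iff _).2 fun _ hu =>
    eigenspace_inner_eq_zero hl h hu (proj_mem f)

theorem proj_eq_zero {b : TestClass} {l c μ : ℝ} (hl : 0 < l) (hc : StrictlyNegative b l c)
    (hμ : μ ≤ 0) (f : H l) : proj b l c μ f = 0 :=
  eigenspace_eq_zero hl hc hμ (proj_mem f)

theorem norm_sum_smul_proj_sq {b : TestClass} {l c : ℝ} (hl : 0 < l) (g : ℝ → ℝ) (f : H l)
    (s : Finset ℝ) :
    ‖∑ μ ∈ s, g μ • proj b l c μ f‖ ^ 2 = ∑ μ ∈ s, g μ ^ 2 * ‖proj b l c μ f‖ ^ 2 := by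
  rw [← real_inner_self_eq_norm_sq, sum_inner]
  refine Finset.sum_congr rfl fun μ hμ => ?_
  rw [inner_sum, Finset.sum_eq_single_of_mem μ hμ]
  · rw [inner_smul_left, inner_smul_right, real_inner_self_eq_norm_sq]
    simp; ring
  · intro ν _ hne
    rw [inner_smul_left, inner_smul_right,
      eigenspace_inner_eq_zero hl hne.symm (proj_mem f) (proj_mem f)]
    simp

/-- Bessel's inequality. -/
theorem sum_norm_proj_sq_le {b : TestClass} {l c : ℝ} (hl : 0 < l) (f : H l) (s : Finset ℝ) :
    ∑ μ ∈ s, ‖proj b l c μ f‖ ^ 2 ≤ ‖f‖ ^ 2 := by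
  have h1 := norm_sum_smul_proj_sq (b := b) (c := c) hl (fun _ => 1) f s
  simp only [one_smul, one_pow, one_mul] at h1
  have h2 : ∑ μ ∈ s, ‖proj b l c μ f‖ ^ 2 = inner ℝ f (∑ μ ∈ s, proj b l c μ f) := by
    rw [inner_sum]
    refine Finset.sum_congr rfl fun μ _ => ?_
    rw [← real_inner_self_eq_norm_sq, inner_proj_left, proj_proj_self]
  have h3 := real_inner_le_norm f (∑ μ ∈ s, proj b l c μ f)
  rw [← h2] at h3
  nlinarith [sq_nonneg (‖f‖ - ‖∑ μ ∈ s, proj b l c μ f‖)]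

theorem summable_norm_proj_sq {b : TestClass} {l c : ℝ} (hl : 0 < l) (f : H l) :
    Summable fun μ => ‖proj b l c μ f‖ ^ 2 :=
  summable_of_sum_le (fun _ => by positivity) (sum_norm_proj_sq_le hl f)

/-- A series converges if the squares of its finite sums are dominated by those of a summable family,
as for orthogonal series with square-summable norms. -/
theorem summable_of_norm_sum_sq_le {ι X : Type*} [NormedAddCommGroup X] [CompleteSpace X]
    {x : ι → X} {a : ι → ℝ} (ha : Summable a) (h : ∀ s : Finset ι, ‖∑ i ∈ s, x i‖ ^ 2 ≤ ∑ i ∈ s, a i) :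
    Summable x := by
  rw [summable_iff_vanishing_norm] at ha ⊢
  intro ε hε
  obtain ⟨s, hs⟩ := ha (ε ^ 2) (by positivity)
  refine ⟨s, fun t ht => ?_⟩
  refine lt_of_pow_lt_pow_left₀ 2 hε.le ?_
  exact (h t).trans_lt ((le_abs_self _).trans_lt (hs t ht))

/-- The spectral multiplier `∑_μ g(μ) P_μ`. -/
def mult (b : TestClass) (l c : ℝ) (g : ℝ → ℝ) (f : H l) : H l :=
  ∑' μ : ℝ, g μ • proj b l c μ f

theorem S_eq_mult (b : TestClass) (l c t : ℝ) (f : H l) :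
    S b l c t f = mult b l c (fun μ => Real.exp (-μ * t)) f := rfl

section

variable {b : TestClass} {l c : ℝ} {g g' : ℝ → ℝ} {C C' : ℝ}

theorem norm_sum_mult_sq_le (hl : 0 < l) (hc : StrictlyNegative b l c)
    (hg : ∀ μ, 0 < μ → |g μ| ≤ C) (f : H l) (s : Finset ℝ) :
    ‖∑ μ ∈ s, g μ • proj b l c μ f‖ ^ 2 ≤ ∑ μ ∈ s, C ^ 2 * ‖proj b l c μ f‖ ^ 2 := by
  rw [norm_sum_smul_proj_sq hl]
  refine Finset.sum_le_sum fun μ _ => ?_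
  rcases le_or_gt μ 0 with h | h
  · simp [proj_eq_zero hl hc h]
  · gcongr 1
    exact sq_le_sq.2 ((hg μ h).trans (le_abs_self C))

theorem summable_mult (hl : 0 < l) (hc : StrictlyNegative b l c)
    (hg : ∀ μ, 0 < μ → |g μ| ≤ C) (f : H l) : Summable fun μ => g μ • proj b l c μ f :=
  summable_of_norm_sum_sq_le ((summable_norm_proj_sq hl f).mul_left (C ^ 2))
    (norm_sum_mult_sq_le hl hc hg f)

theorem norm_mult_le (hl : 0 < l) (hc : StrictlyNegative b l c)
    (hg : ∀ μ, 0 < μ → |g μ| ≤ C) (f : H l) : ‖mult b l c g f‖ ≤ C * ‖f‖ := by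
  have hC : 0 ≤ C := (abs_nonneg _).trans (hg 1 one_pos)
  refine abs_le_of_sq_le_sq' ?_ (by positivity) |>.2
  refine le_of_tendsto' ((summable_mult hl hc hg f).hasSum.norm.pow 2) fun s => ?_
  refine (norm_sum_mult_sq_le hl hc hg f s).trans ?_
  rw [← Finset.mul_sum, mul_pow]
  exact mul_le_mul_of_nonneg_left (sum_norm_proj_sq_le hl f s) (by positivity)

theorem mult_add (hl : 0 < l) (hc : StrictlyNegative b l c)
    (hg : ∀ μ, 0 < μ → |g μ| ≤ C) (f f' : H l) :
    mult b l c g (f + f') = mult b l c g f + mult b l c g f' := by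
  rw [mult, mult, mult, ← (summable_mult hl hc hg f).tsum_add (summable_mult hl hc hg f')]
  simp

theorem mult_smul (a : ℝ) (f : H l) : mult b l c g (a • f) = a • mult b l c g f := by
  rw [mult, mult, ← tsum_const_smul'']
  simp only [map_smul]
  exact tsum_congr fun μ => smul_comm _ _ _

theorem mult_fun_sub (hl : 0 < l) (hc : StrictlyNegative b l c)
    (hg : ∀ μ, 0 < μ → |g μ| ≤ C) (hg' : ∀ μ, 0 < μ → |g' μ| ≤ C') (f : H l) :
    mult b l c g f - mult b l c g' f = mult b l c (fun μ => g μ - g' μ) f := by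
  rw [mult, mult, mult, ← (summable_mult hl hc hg f).tsum_sub (summable_mult hl hc hg' f)]
  simp [sub_smul]

theorem inner_mult (hl : 0 < l) (hc : StrictlyNegative b l c)
    (hg : ∀ μ, 0 < μ → |g μ| ≤ C) (f f' : H l) :
    inner ℝ (mult b l c g f) f' = inner ℝ f (mult b l c g f') := by
  have h1 := (innerSL ℝ f').hasSum (summable_mult hl hc hg f).hasSum
  have h2 := (innerSL ℝ f).hasSum (summable_mult hl hc hg f').hasSum
  simp only [innerSL_apply_apply] at h1 h2
  have : (fun μ => inner ℝ f' (g μ • proj b l c μ f)) =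
      fun μ => inner ℝ f (g μ • proj b l c μ f') := by
    ext μ
    rw [inner_smul_right, inner_smul_right, real_inner_comm, inner_proj_left]
  rw [this] at h1
  rw [real_inner_comm]
  exact h1.unique h2

theorem proj_mult (hl : 0 < l) (hc : StrictlyNegative b l c)
    (hg : ∀ μ, 0 < μ → |g μ| ≤ C) (f : H l) (μ : ℝ) :
    proj b l c μ (mult b l c g f) = g μ • proj b l c μ f := by
  rw [mult, (proj b l c μ).map_tsum (summable_mult hl hc hg f), tsum_eq_single μ]
  · rw [map_smul, proj_proj_self]
  · intro ν hν
    rw [map_smul, proj_proj_ne hl hν.symm, smul_zero]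

theorem mult_mult (hl : 0 < l) (hc : StrictlyNegative b l c)
    (hg' : ∀ μ, 0 < μ → |g' μ| ≤ C') (f : H l) :
    mult b l c g (mult b l c g' f) = mult b l c (fun μ => g μ * g' μ) f := by
  refine tsum_congr fun μ => ?_
  rw [proj_mult hl hc hg', smul_smul]

end

/-! ### The semigroup -/

section

variable {b : TestClass} {l c : ℝ}

theorem abs_exp_le_one {t : ℝ} (ht : 0 ≤ t) : ∀ μ : ℝ, 0 < μ → |Real.exp (-μ * t)| ≤ 1 := by
  intro μ hμ
  rw [abs_of_pos (Real.exp_pos _), Real.exp_le_one_iff]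
  nlinarith

theorem norm_S_le (hl : 0 < l) (hc : StrictlyNegative b l c) {t : ℝ} (ht : 0 ≤ t) (f : H l) :
    ‖S b l c t f‖ ≤ ‖f‖ := by
  rw [← one_mul ‖f‖]
  exact norm_mult_le hl hc (abs_exp_le_one ht) f

theorem S_add (hl : 0 < l) (hc : StrictlyNegative b l c) {t : ℝ} (ht : 0 ≤ t) (f g : H l) :
    S b l c t (f + g) = S b l c t f + S b l c t g := mult_add hl hc (abs_exp_le_one ht) f g

theorem S_smul (t a : ℝ) (f : H l) : S b l c t (a • f) = a • S b l c t f := mult_smul a f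

theorem S_sub (hl : 0 < l) (hc : StrictlyNegative b l c) {t : ℝ} (ht : 0 ≤ t) (f g : H l) :
    S b l c t (f - g) = S b l c t f - S b l c t g := by
  have : f - g = f + (-1 : ℝ) • g := by simp [sub_eq_add_neg]
  rw [this, S_add hl hc ht, S_smul]
  simp [sub_eq_add_neg]

theorem inner_S (hl : 0 < l) (hc : StrictlyNegative b l c) {t : ℝ} (ht : 0 ≤ t) (f g : H l) :
    inner ℝ (S b l c t f) g = inner ℝ f (S b l c t g) := inner_mult hl hc (abs_exp_le_one ht) f g

theorem S_S (hl : 0 < l) (hc : StrictlyNegative b l c) (s : ℝ) {t : ℝ} (ht : 0 ≤ t)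
    (f : H l) : S b l c s (S b l c t f) = S b l c (s + t) f := by
  simp only [S_eq_mult]
  rw [mult_mult hl hc (abs_exp_le_one ht)]
  congr 1
  ext μ
  rw [← Real.exp_add]
  ring_nf

/-- `e^{-μs} - e^{-μt} ≤ (t - s) μ e^{-μs} ≤ (t - s) / s` for `μ > 0`. -/
theorem norm_S_sub_S_le (hl : 0 < l) (hc : StrictlyNegative b l c) {s t : ℝ} (hs : 0 < s)
    (hst : s ≤ t) (f : H l) : ‖S b l c s f - S b l c t f‖ ≤ (t - s) / s * ‖f‖ := by
  simp only [S_eq_mult]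
  rw [mult_fun_sub hl hc (abs_exp_le_one hs.le) (abs_exp_le_one (hs.le.trans hst))]
  refine norm_mult_le hl hc (fun μ hμ => ?_) f
  have h1 : Real.exp (-μ * t) = Real.exp (-μ * s) * Real.exp (-(μ * (t - s))) := by
    rw [← Real.exp_add]; ring_nf
  have h2 : 1 - μ * (t - s) ≤ Real.exp (-(μ * (t - s))) := by
    have := Real.add_one_le_exp (-(μ * (t - s))); linarith
  have h3 : Real.exp (-(μ * (t - s))) ≤ 1 := by
    rw [Real.exp_le_one_iff]
    have := mul_nonneg hμ.le (sub_nonneg.2 hst); linarith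
  have h4 : Real.exp (-μ * s) * (μ * s) ≤ 1 := by
    have h5 := Real.add_one_le_exp (μ * s)
    have h6 : Real.exp (-μ * s) * Real.exp (μ * s) = 1 := by
      rw [← Real.exp_add]; simp
    rw [← h6]
    exact mul_le_mul_of_nonneg_left (by linarith) (Real.exp_pos _).le
  have h7 := Real.exp_pos (-μ * s)
  rw [h1, abs_of_nonneg (by nlinarith), le_div_iff₀ hs]
  calc (Real.exp (-μ * s) - Real.exp (-μ * s) * Real.exp (-(μ * (t - s)))) * s
      = Real.exp (-μ * s) * s * (1 - Real.exp (-(μ * (t - s)))) := by ring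
    _ ≤ Real.exp (-μ * s) * s * (μ * (t - s)) := by gcongr; linarith
    _ = Real.exp (-μ * s) * (μ * s) * (t - s) := by ring
    _ ≤ 1 * (t - s) := by gcongr
    _ = t - s := one_mul _

theorem continuousOn_S (hl : 0 < l) (hc : StrictlyNegative b l c) :
    ContinuousOn (fun p : ℝ × H l => S b l c p.1 p.2) (Ioi 0 ×ˢ univ) := by
  rintro ⟨t₀, f₀⟩ ⟨ht₀, -⟩
  have ht₀ : 0 < t₀ := ht₀
  refine ContinuousAt.continuousWithinAt ?_
  rw [ContinuousAt, tendsto_iff_norm_sub_tendsto_zero]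
  have hnear : ∀ᶠ p : ℝ × H l in 𝓝 (t₀, f₀), t₀ / 2 < p.1 :=
    (isOpen_lt continuous_const continuous_fst).mem_nhds (by simpa using ht₀)
  have hb : ∀ᶠ p : ℝ × H l in 𝓝 (t₀, f₀), ‖S b l c p.1 p.2 - S b l c t₀ f₀‖ ≤
      ‖p.2 - f₀‖ + |p.1 - t₀| / (t₀ / 2) * ‖f₀‖ := by
    filter_upwards [hnear] with p hp
    have hp0 : 0 < p.1 := by linarith
    have h1 : S b l c p.1 p.2 - S b l c t₀ f₀ =
        S b l c p.1 (p.2 - f₀) + (S b l c p.1 f₀ - S b l c t₀ f₀) := by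
      rw [S_sub hl hc hp0.le]; abel
    rw [h1]
    refine (norm_add_le _ _).trans (add_le_add (norm_S_le hl hc hp0.le _) ?_)
    rcases le_total p.1 t₀ with h | h
    · refine (norm_S_sub_S_le hl hc hp0 h f₀).trans ?_
      rw [abs_sub_comm, abs_of_nonneg (by linarith)]
      gcongr
    · rw [norm_sub_rev]
      refine (norm_S_sub_S_le hl hc ht₀ h f₀).trans ?_
      rw [abs_of_nonneg (by linarith)]
      gcongr
      linarith
  refine squeeze_zero' (.of_forall fun _ => norm_nonneg _) hb ?_
  have : Continuous fun p : ℝ × H l => ‖p.2 - f₀‖ + |p.1 - t₀| / (t₀ / 2) * ‖f₀‖ := by fun_prop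
  simpa using this.tendsto (t₀, f₀)

/-- Parabolic smoothing: for `t > 0`, `S(t) f` lies in `H₀²(I)`, with
`‖(S(t) f)_xx‖ ≲ t^{-1/2} ‖f‖` for small `t`. -/
theorem S_smoothing (hl : 0 < l) (hc : StrictlyNegative b l c) {t : ℝ} (ht : 0 < t) (f : H l) :
    ∃ U ∈ H0 b l 2, U 0 = S b l c t f ∧ ‖U 2‖ ^ 2 ≤ (1 / t + (1 + 2 * |c|)) * ‖f‖ ^ 2 := by
  -- The finite sums `∑ e^{-μt} V_μ`, with `V_μ ∈ H₀²(I)` over `P_μ f`, are Cauchy in `H₀²(I)`, since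
  -- they are orthogonal for `H` and for the form and `μ e^{-2μt} ≤ 1/(2t)`.
  choose V hV hV0 using fun μ => exists_eigenLift hl (proj_mem (b := b) (c := c) (μ := μ) f)
  let x : ℝ → PiLp 2 (fun _ : Fin 3 => H l) := fun μ => Real.exp (-μ * t) • V μ
  have hx : ∀ μ, x μ ∈ H0 b l 2 := fun μ => Submodule.smul_mem _ _ (hV μ).1
  have hsx : ∀ s : Finset ℝ, ∑ μ ∈ s, x μ ∈ H0 b l 2 := fun s =>
    Submodule.sum_mem _ fun μ _ => hx μ
  have hx0 : ∀ s : Finset ℝ, (∑ μ ∈ s, x μ) 0 = ∑ μ ∈ s, Real.exp (-μ * t) • proj b l c μ f := by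
    intro s
    have := map_sum (PiLp.proj (𝕜 := ℝ) 2 (fun _ : Fin 3 => H l) 0) x s
    simp only [PiLp.proj_apply] at this
    rw [this]
    exact Finset.sum_congr rfl fun μ _ => by simp [x, hV0]
  have hn0 : ∀ s : Finset ℝ, ‖(∑ μ ∈ s, x μ) 0‖ ^ 2 ≤ ∑ μ ∈ s, ‖proj b l c μ f‖ ^ 2 := by
    intro s
    rw [hx0]
    simpa using norm_sum_mult_sq_le hl hc (abs_exp_le_one ht.le) f s
  have hform : ∀ s : Finset ℝ, form l c (∑ μ ∈ s, x μ) (∑ μ ∈ s, x μ) ≤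
      1 / (2 * t) * ∑ μ ∈ s, ‖proj b l c μ f‖ ^ 2 := by
    intro s
    conv_lhs => rw [map_sum]
    rw [Finset.mul_sum]
    refine Finset.sum_le_sum fun μ hμ => ?_
    have h1 : inner ℝ (proj b l c μ f) (∑ ν ∈ s, Real.exp (-ν * t) • proj b l c ν f) =
        Real.exp (-μ * t) * ‖proj b l c μ f‖ ^ 2 := by
      rw [inner_sum, Finset.sum_eq_single_of_mem μ hμ]
      · rw [inner_smul_right, real_inner_self_eq_norm_sq]
      · intro ν _ hne
        rw [inner_smul_right, eigenspace_inner_eq_zero hl hne.symm (proj_mem f) (proj_mem f),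
          mul_zero]
    rw [map_smul, (hV μ).2 _ (hsx s), hV0, hx0, h1, smul_eq_mul]
    rcases le_or_gt μ 0 with h | h
    · simp [proj_eq_zero hl hc h]
    have h2 : Real.exp (-μ * t) * (μ * Real.exp (-μ * t)) ≤ 1 / (2 * t) := by
      rw [le_div_iff₀ (by positivity)]
      have h5 := Real.add_one_le_exp (2 * μ * t)
      have h6 : Real.exp (-μ * t) * Real.exp (-μ * t) * Real.exp (2 * μ * t) = 1 := by
        rw [← Real.exp_add, ← Real.exp_add]; ring_nf; simp
      rw [← h6]
      calc _ = Real.exp (-μ * t) * Real.exp (-μ * t) * (2 * μ * t) := by ring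
        _ ≤ _ := mul_le_mul_of_nonneg_left (by linarith) (by positivity)
    calc _ = Real.exp (-μ * t) * (μ * Real.exp (-μ * t)) * ‖proj b l c μ f‖ ^ 2 := by ring
      _ ≤ _ := mul_le_mul_of_nonneg_right h2 (by positivity)
  have hsum : Summable x := by
    refine summable_of_norm_sum_sq_le ((summable_norm_proj_sq (b := b) (c := c) hl f).mul_left
      (3 * (1 / (2 * t)) + (3 + 3 * |c|))) fun s => ?_
    refine (norm_sq_le_form hl c (hsx s)).trans ?_
    rw [← Finset.mul_sum, add_mul, mul_assoc 3]
    have h3 : 0 ≤ 3 + 3 * |c| := by positivity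
    have h4 := hform s
    have h5 := mul_le_mul_of_nonneg_left (hn0 s) h3
    linarith
  refine ⟨∑' μ, x μ, ?_, ?_, ?_⟩
  · exact (Submodule.isClosed_topologicalClosure _).mem_of_tendsto hsum.hasSum (.of_forall hsx)
  · have h1 := ((PiLp.continuous_apply 2 (fun _ : Fin 3 => H l) 0).tendsto _).comp hsum.hasSum
    refine tendsto_nhds_unique h1 ?_
    refine (summable_mult (f := f) hl hc (abs_exp_le_one ht.le)).hasSum.congr fun s => ?_
    exact (hx0 s).symm
  · have h1 := ((PiLp.continuous_apply 2 (fun _ : Fin 3 => H l) 2).tendsto _).comp hsum.hasSum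
    refine le_of_tendsto' (h1.norm.pow 2) fun s => ?_
    refine (norm_two_sq_le hl c (hsx s)).trans ?_
    have hB := sum_norm_proj_sq_le (b := b) (c := c) hl f s
    calc _ ≤ 2 * (1 / (2 * t) * ‖f‖ ^ 2) + (1 + 2 * |c|) * ‖f‖ ^ 2 := by
          gcongr ?_ + ?_
          · exact mul_le_mul_of_nonneg_left
              ((hform s).trans (mul_le_mul_of_nonneg_left hB (by positivity))) (by norm_num)
          · exact mul_le_mul_of_nonneg_left ((hn0 s).trans hB) (by positivity)
      _ = _ := by field_simp

end

/-! ### Smoothing estimates in `L⁴(I)` -/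

section

variable {b : TestClass} {l c : ℝ}

/-- `S(t) f` lies in `V`, with `‖(S(t) f)'‖ ≲ t^{-1/4} ‖f‖`. -/
theorem exists_V_eq_S (hl : 0 < l) (hc : StrictlyNegative b l c) {t T : ℝ} (ht : 0 < t)
    (htT : t ≤ T) (f : H l) : ∃ u : V b l, u.1 0 = S b l c t f ∧
      ‖u.1 1‖ ^ 4 ≤ (1 + (1 + 2 * |c|) * T) / t * ‖f‖ ^ 4 := by
  obtain ⟨U, hU, hU0, hU2⟩ := S_smoothing hl hc ht f
  obtain ⟨u, hu0, hu1⟩ := exists_H0_one hU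
  refine ⟨u, hu0.trans hU0, ?_⟩
  have h1 := norm_one_sq_le hl hU
  have h0 : ‖U 0‖ ≤ ‖f‖ := hU0 ▸ norm_S_le hl hc ht.le f
  have hT : 1 / t + (1 + 2 * |c|) ≤ (1 + (1 + 2 * |c|) * T) / t := by
    rw [add_div, mul_div_assoc]
    gcongr
    refine le_mul_of_one_le_right (by positivity) ?_
    rwa [le_div_iff₀ ht, one_mul]
  rw [hu1]
  calc ‖U 1‖ ^ 4 = (‖U 1‖ ^ 2) ^ 2 := by ring
    _ ≤ (‖U 0‖ * ‖U 2‖) ^ 2 := by gcongr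
    _ = ‖U 0‖ ^ 2 * ‖U 2‖ ^ 2 := by ring
    _ ≤ ‖f‖ ^ 2 * ((1 + (1 + 2 * |c|) * T) / t * ‖f‖ ^ 2) := by
        gcongr
        exact hU2.trans (by gcongr)
    _ = _ := by ring

/-- `S(t)` as a map `H → L⁴(I)`, for `t > 0` (with the value `0` where `S(t) f` is not in `L⁴`). -/
def S4 (b : TestClass) (l c t : ℝ) (f : H l) : L4 l :=
  open Classical in if h : MemLp (S b l c t f) 4 (muI l) then h.toLp _ else 0

theorem S4_eq_embV {t : ℝ} {f : H l} {u : V b l} (h : u.1 0 = S b l c t f) :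
    S4 b l c t f = embV b l u := by
  have hm : MemLp (S b l c t f) 4 (muI l) := h ▸ memLp_four u
  rw [S4, dif_pos hm]
  refine Lp.ext (hm.coeFn_toLp.trans ?_)
  rw [← h]
  exact (embV_coe u).symm

theorem S4_coe (hl : 0 < l) (hc : StrictlyNegative b l c) {t : ℝ} (ht : 0 < t) (f : H l) :
    ⇑(S4 b l c t f) =ᵐ[muI l] S b l c t f := by
  obtain ⟨u, hu, -⟩ := exists_V_eq_S hl hc ht le_rfl f
  rw [S4_eq_embV hu, ← hu]
  exact embV_coe u

theorem S4_S (hl : 0 < l) (hc : StrictlyNegative b l c) (s : ℝ) {t : ℝ} (ht : 0 ≤ t)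
    (f : H l) : S4 b l c s (S b l c t f) = S4 b l c (s + t) f := by
  have h := S_S hl hc s ht f
  unfold S4
  generalize S b l c s (S b l c t f) = g at *
  subst h
  rfl

theorem S4_add (hl : 0 < l) (hc : StrictlyNegative b l c) {t : ℝ} (ht : 0 < t) (f g : H l) :
    S4 b l c t (f + g) = S4 b l c t f + S4 b l c t g := by
  obtain ⟨u, hu, -⟩ := exists_V_eq_S hl hc ht le_rfl f
  obtain ⟨v, hv, -⟩ := exists_V_eq_S hl hc ht le_rfl g
  have : (u + v).1 0 = S b l c t (f + g) := by
    rw [S_add hl hc ht.le, ← hu, ← hv]; rfl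
  rw [S4_eq_embV hu, S4_eq_embV hv, S4_eq_embV this, map_add]

theorem S4_smul (hl : 0 < l) (hc : StrictlyNegative b l c) {t : ℝ} (ht : 0 < t) (a : ℝ)
    (f : H l) : S4 b l c t (a • f) = a • S4 b l c t f := by
  obtain ⟨u, hu, -⟩ := exists_V_eq_S hl hc ht le_rfl f
  have : (a • u).1 0 = S b l c t (a • f) := by
    rw [S_smul, ← hu]; rfl
  rw [S4_eq_embV hu, S4_eq_embV this, map_smul]

theorem S4_sub (hl : 0 < l) (hc : StrictlyNegative b l c) {t : ℝ} (ht : 0 < t) (f g : H l) :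
    S4 b l c t (f - g) = S4 b l c t f - S4 b l c t g := by
  have : f - g = f + (-1 : ℝ) • g := by simp [sub_eq_add_neg]
  rw [this, S4_add hl hc ht, S4_smul hl hc ht]
  simp [sub_eq_add_neg]

/-- The exponent `1/16` comes from `‖v‖₄⁴ ≤ 2 ‖v‖³ ‖v'‖` and `‖(S(t) f)'‖ ≲ t^{-1/4} ‖f‖`. -/
theorem exists_norm_S4_le (hl : 0 < l) (hc : StrictlyNegative b l c) {T : ℝ} (hT : 0 < T) :
    ∃ K > 0, ∀ t, 0 < t → t ≤ T → ∀ f, ‖S4 b l c t f‖ ≤ K * t ^ (-(1 / 16) : ℝ) * ‖f‖ := by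
  have hKp : 0 < 1 + (1 + 2 * |c|) * T := by positivity
  set K := 1 + (1 + 2 * |c|) * T with hK
  refine ⟨(16 * K) ^ ((1 / 16) : ℝ), by positivity, fun t ht htT f => ?_⟩
  obtain ⟨u, hu, hu1⟩ := exists_V_eq_S hl hc ht htT f
  rw [S4_eq_embV hu]
  have h0 : ‖u.1 0‖ ≤ ‖f‖ := hu ▸ norm_S_le hl hc ht.le f
  refine le_of_pow_le_pow_left₀ (n := 16) (by norm_num) (by positivity) ?_
  have e1 : ((16 * K) ^ ((1 / 16) : ℝ)) ^ 16 = 16 * K := by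
    rw [← Real.rpow_natCast, ← Real.rpow_mul (by positivity)]; norm_num
  have e2 : (t ^ (-(1 / 16) : ℝ)) ^ 16 = 1 / t := by
    rw [← Real.rpow_natCast, ← Real.rpow_mul ht.le]
    norm_num [Real.rpow_neg_one]
  rw [mul_pow, mul_pow, e1, e2]
  calc ‖embV b l u‖ ^ 16 = (‖embV b l u‖ ^ 4) ^ 4 := by ring
    _ ≤ (2 * (‖u.1 0‖ ^ 3 * ‖u.1 1‖)) ^ 4 := by gcongr; exact norm_embV_pow_le u
    _ = 16 * ((‖u.1 0‖ ^ 12) * ‖u.1 1‖ ^ 4) := by ring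
    _ ≤ 16 * (‖f‖ ^ 12 * (K / t * ‖f‖ ^ 4)) := by gcongr
    _ = _ := by ring

/-- The smoothing estimate for the derivative in the nonlinearity, by duality. -/
theorem exists_norm_S_G0_sub_le (hl : 0 < l) (hc : StrictlyNegative b l c) {T : ℝ} (hT : 0 < T) :
    ∃ K > 0, ∀ t, 0 < t → t ≤ T → ∀ u v : V b l, ‖S b l c t (G0 b l c u - G0 b l c v)‖ ≤
      K * t ^ (-(1 / 4) : ℝ) * (‖embV b l u - embV b l v‖ * (‖embV b l u + embV b l v‖ + 1)) := by
  have hKp : 0 < 1 + (1 + 2 * |c|) * T := by positivity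
  set K := 1 + (1 + 2 * |c|) * T with hK
  obtain ⟨ι, hι⟩ := exists_embH l
  refine ⟨K ^ ((1 / 4) : ℝ) + |c| * ‖ι‖ * T ^ ((1 / 4) : ℝ), by positivity,
    fun t ht htT u v => ?_⟩
  set x := S b l c t (G0 b l c u - G0 b l c v) with hx
  set p := ‖embV b l u - embV b l v‖ with hp
  set q := ‖embV b l u + embV b l v‖ with hq
  obtain ⟨w, hw, hw1⟩ := exists_V_eq_S hl hc ht htT x
  have hw0 : ‖w.1 0‖ ≤ ‖x‖ := hw ▸ norm_S_le hl hc ht.le x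
  have e1 : (K ^ ((1 / 4) : ℝ)) ^ 4 = K := by
    rw [← Real.rpow_natCast, ← Real.rpow_mul (by positivity)]; norm_num
  have e2 : (t ^ (-(1 / 4) : ℝ)) ^ 4 = 1 / t := by
    rw [← Real.rpow_natCast, ← Real.rpow_mul ht.le]
    norm_num [Real.rpow_neg_one]
  have hw1' : ‖w.1 1‖ ≤ K ^ ((1 / 4) : ℝ) * t ^ (-(1 / 4) : ℝ) * ‖x‖ := by
    refine le_of_pow_le_pow_left₀ (n := 4) (by norm_num) (by positivity) ?_
    rw [mul_pow, mul_pow, e1, e2]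
    refine hw1.trans_eq (by ring)
  have hT4 : 1 ≤ T ^ ((1 / 4) : ℝ) * t ^ (-(1 / 4) : ℝ) := by
    rw [Real.rpow_neg ht.le, ← div_eq_mul_inv, one_le_div (by positivity)]
    exact Real.rpow_le_rpow ht.le htT (by norm_num)
  have huv : ‖u.1 0 - v.1 0‖ ≤ ‖ι‖ * p := by
    have : u.1 0 - v.1 0 = ι (embV b l u - embV b l v) := by
      rw [map_sub]
      congr 1
      · exact Lp.ext ((hι _).trans (embV_coe u)).symm
      · exact Lp.ext ((hι _).trans (embV_coe v)).symm
    rw [this]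
    exact ι.le_opNorm _
  have hsq := norm_sq_sub_sq_le u v
  -- `‖x‖² = ⟨G₀ u - G₀ v, S(t) x⟩`, and the derivative falls on `w = S(t) x`.
  have key : ‖x‖ ^ 2 = 1 / 2 * inner ℝ (mulV b l u (u.1 0) - mulV b l v (v.1 0)) (w.1 1) +
      c * inner ℝ (u.1 0 - v.1 0) (w.1 0) := by
    rw [← real_inner_self_eq_norm_sq]
    conv_lhs => rw [hx]
    rw [inner_S hl hc ht.le, ← hw, G0_eq, G0_eq]
    simp only [inner_sub_left, inner_add_left, inner_neg_left, inner_smul_left,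
      inner_mulV_deriv hl, conj_trivial]
    ring
  have b1 : inner ℝ (mulV b l u (u.1 0) - mulV b l v (v.1 0)) (w.1 1) ≤
      p * q * (K ^ ((1 / 4) : ℝ) * t ^ (-(1 / 4) : ℝ) * ‖x‖) :=
    (real_inner_le_norm _ _).trans (by gcongr)
  have b2 : c * inner ℝ (u.1 0 - v.1 0) (w.1 0) ≤ |c| * (‖ι‖ * p * ‖x‖) := by
    refine (le_abs_self _).trans ?_
    rw [abs_mul]
    gcongr
    exact (abs_real_inner_le_norm _ _).trans (by gcongr)
  have hp0 : 0 ≤ p := norm_nonneg _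
  have hq0 : 0 ≤ q := norm_nonneg _
  have main : ‖x‖ ^ 2 ≤ (K ^ ((1 / 4) : ℝ) + |c| * ‖ι‖ * T ^ ((1 / 4) : ℝ)) *
      t ^ (-(1 / 4) : ℝ) * (p * (q + 1)) * ‖x‖ := by
    have s1 : 1 / 2 * (p * q * (K ^ ((1 / 4) : ℝ) * t ^ (-(1 / 4) : ℝ) * ‖x‖)) ≤
        p * (q + 1) * (K ^ ((1 / 4) : ℝ) * t ^ (-(1 / 4) : ℝ) * ‖x‖) := by
      rw [← mul_assoc]
      gcongr ?_ * _
      nlinarith [mul_nonneg hp0 hq0]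
    have s2 : |c| * (‖ι‖ * p * ‖x‖) ≤
        |c| * ‖ι‖ * (p * (q + 1)) * ‖x‖ * (T ^ ((1 / 4) : ℝ) * t ^ (-(1 / 4) : ℝ)) := by
      have s3 : |c| * (‖ι‖ * p * ‖x‖) ≤ |c| * ‖ι‖ * (p * (q + 1)) * ‖x‖ := by
        have : p ≤ p * (q + 1) := le_mul_of_one_le_right hp0 (by linarith)
        calc |c| * (‖ι‖ * p * ‖x‖) = |c| * ‖ι‖ * p * ‖x‖ := by ring
          _ ≤ _ := by gcongr
      exact s3.trans (le_mul_of_one_le_right (by positivity) hT4)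
    rw [key]
    nlinarith
  rcases (norm_nonneg x).eq_or_lt with h | h
  · rw [← h]; positivity
  · rw [sq] at main
    exact le_of_mul_le_mul_right main h

theorem exists_norm_S4_G0_sub_le (hl : 0 < l) (hc : StrictlyNegative b l c) {T : ℝ} (hT : 0 < T) :
    ∃ K > 0, ∀ t, 0 < t → t ≤ T → ∀ u v : V b l, ‖S4 b l c t (G0 b l c u - G0 b l c v)‖ ≤
      K * t ^ (-(5 / 16) : ℝ) * (‖embV b l u - embV b l v‖ * (‖embV b l u + embV b l v‖ + 1)) := by
  obtain ⟨K, hK, h1⟩ := exists_norm_S4_le hl hc hT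
  obtain ⟨K', hK', h2⟩ := exists_norm_S_G0_sub_le hl hc hT
  refine ⟨K * K' * (1 / 2 : ℝ) ^ (-(5 / 16) : ℝ), by positivity, fun t ht htT u v => ?_⟩
  -- `S(t) = S(t/2) S(t/2)`: one half absorbs the derivative, the other maps `H` to `L⁴(I)`.
  have ht2 : 0 < t / 2 := by positivity
  have h3 := h1 (t / 2) ht2 (by linarith) (S b l c (t / 2) (G0 b l c u - G0 b l c v))
  rw [S4_S hl hc _ ht2.le, add_halves] at h3
  refine h3.trans ?_
  have h4 := h2 (t / 2) ht2 (by linarith) u v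
  have e : (1 / 2 : ℝ) ^ (-(5 / 16) : ℝ) * t ^ (-(5 / 16) : ℝ) =
      (t / 2) ^ (-(1 / 16) : ℝ) * (t / 2) ^ (-(1 / 4) : ℝ) := by
    rw [← Real.rpow_add ht2, ← Real.mul_rpow (by norm_num) ht.le]
    norm_num
    ring_nf
  calc _ ≤ K * (t / 2) ^ (-(1 / 16) : ℝ) * (K' * (t / 2) ^ (-(1 / 4) : ℝ) *
        (‖embV b l u - embV b l v‖ * (‖embV b l u + embV b l v‖ + 1))) := by gcongr
    _ = K * K' * ((t / 2) ^ (-(1 / 16) : ℝ) * (t / 2) ^ (-(1 / 4) : ℝ)) *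
        (‖embV b l u - embV b l v‖ * (‖embV b l u + embV b l v‖ + 1)) := by ring
    _ = _ := by rw [← e]; ring

theorem continuous_S4 (hl : 0 < l) (hc : StrictlyNegative b l c) {t : ℝ} (ht : 0 < t) :
    Continuous (S4 b l c t) := by
  obtain ⟨K, hK, h⟩ := exists_norm_S4_le hl hc ht
  let A : H l →ₗ[ℝ] L4 l :=
    { toFun := S4 b l c t
      map_add' := S4_add hl hc ht
      map_smul' := S4_smul hl hc ht }
  exact (A.mkContinuous _ (h t ht le_rfl)).continuous

theorem continuousOn_S4 (hl : 0 < l) (hc : StrictlyNegative b l c) :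
    ContinuousOn (fun p : ℝ × H l => S4 b l c p.1 p.2) (Ioi 0 ×ˢ univ) := by
  rintro ⟨t₀, f₀⟩ ⟨ht₀, -⟩
  have ht₀ : 0 < t₀ := ht₀
  refine ContinuousAt.continuousWithinAt ?_
  -- Near `t₀`, `S(t) = S(t₀/2) S(t - t₀/2)`, where the outer factor is bounded from `H` to `L⁴(I)`.
  have hnear : ∀ᶠ p : ℝ × H l in 𝓝 (t₀, f₀), t₀ / 2 < p.1 :=
    (isOpen_lt continuous_const continuous_fst).mem_nhds (by simpa using ht₀)
  have he : (fun p : ℝ × H l => S4 b l c p.1 p.2) =ᶠ[𝓝 (t₀, f₀)]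
      fun p => S4 b l c (t₀ / 2) (S b l c (p.1 - t₀ / 2) p.2) := by
    filter_upwards [hnear] with p hp
    rw [S4_S hl hc _ (by linarith)]
    congr 1
    ring
  refine ContinuousAt.congr_of_eventuallyEq ?_ he
  have h1 : ContinuousAt (fun p : ℝ × H l => S b l c p.1 p.2) (t₀ - t₀ / 2, f₀) :=
    (continuousOn_S hl hc).continuousAt ((isOpen_Ioi.prod isOpen_univ).mem_nhds
      ⟨by simp only [mem_Ioi]; linarith, mem_univ _⟩)
  have h2 : ContinuousAt (fun p : ℝ × H l => (p.1 - t₀ / 2, p.2)) (t₀, f₀) := by fun_prop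
  exact (continuous_S4 hl hc (half_pos ht₀)).continuousAt.comp
    (ContinuousAt.comp (f := fun p : ℝ × H l => (p.1 - t₀ / 2, p.2))
      (g := fun p : ℝ × H l => S b l c p.1 p.2) h1 h2)

end

/-! ### The Duhamel operator -/

/-- Hölder's inequality with exponents `2, 4, 4`. -/
theorem integral_mul_mul_le {α : Type*} [MeasurableSpace α] {μ : Measure α} {f g h : α → ℝ}
    (hf : MemLp f 2 μ) (hg : MemLp g 4 μ) (hh : MemLp h 4 μ) :
    Integrable (fun x => f x * (g x * h x)) μ ∧ ∫ x, f x * (g x * h x) ∂μ ≤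
      (eLpNorm f 2 μ).toReal * ((eLpNorm g 4 μ).toReal * (eLpNorm h 4 μ).toReal) := by
  have hgh : MemLp (fun x => g x * h x) 2 μ := hh.mul (r := 2) hg
  have hi : Integrable (fun x => f x * (g x * h x)) μ := hf.integrable_mul hgh
  refine ⟨hi, ?_⟩
  refine (integral_mono hi hi.norm fun x => le_abs_self _).trans ?_
  rw [integral_norm_eq_lintegral_enorm hi.aestronglyMeasurable, ← eLpNorm_one_eq_lintegral_enorm,
    ← ENNReal.toReal_mul, ← ENNReal.toReal_mul]
  refine ENNReal.toReal_mono (ENNReal.mul_ne_top hf.eLpNorm_ne_top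
    (ENNReal.mul_ne_top hg.eLpNorm_ne_top hh.eLpNorm_ne_top)) ?_
  have h1 : eLpNorm (f • (g • h)) 1 μ ≤ eLpNorm f 2 μ * eLpNorm (g • h) 2 μ :=
    eLpNorm_smul_le_mul_eLpNorm hgh.aestronglyMeasurable hf.aestronglyMeasurable
  have h2 : eLpNorm (g • h) 2 μ ≤ eLpNorm g 4 μ * eLpNorm h 4 μ :=
    eLpNorm_smul_le_mul_eLpNorm hh.aestronglyMeasurable hg.aestronglyMeasurable
  exact h1.trans (mul_le_mul_right h2 _)

section

variable {b : TestClass} {l c : ℝ}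

theorem Represents.unique {τ : ℝ} {z z' : E l τ} {f : ℝ → H l} (h : Represents l τ z f)
    (h' : Represents l τ z' f) : z = z' := by
  refine Lp.ext ?_
  filter_upwards [h, h'] with t h1 h2
  exact Lp.ext (h1.trans h2.symm)

/-- The choice in `toE` is immaterial. -/
theorem toE_eq {τ : ℝ} {z : E l τ} {f : ℝ → H l} (h : Represents l τ z f) : toE l τ f = z := by
  have hex : ∃ z : E l τ, Represents l τ z f := ⟨z, h⟩
  rw [toE, dif_pos hex]
  exact hex.choose_spec.unique h

/-- The linear evolution `t ↦ S(t) u₀` belongs to `E`, since `(t^{-1/16})⁴` is integrable. -/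
theorem toE_S_ae (hl : 0 < l) (hc : StrictlyNegative b l c) {τ : ℝ} (hτ : 0 < τ) (u₀ : H l) :
    ∀ᵐ t ∂(volume.restrict (Ioo 0 τ)), toE l τ (fun t => S b l c t u₀) t = S4 b l c t u₀ := by
  obtain ⟨K, hK, hb⟩ := exists_norm_S4_le hl hc hτ
  have hcont : ContinuousOn (fun t => S4 b l c t u₀) (Ioo 0 τ) := by
    refine (continuousOn_S4 hl hc).comp (f := fun t => (t, u₀)) (by fun_prop) ?_
    intro t ht
    exact ⟨ht.1, mem_univ _⟩
  have hmeas := hcont.aestronglyMeasurable (μ := volume) measurableSet_Ioo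
  have hm : MemLp (fun t => S4 b l c t u₀) 4 (volume.restrict (Ioo 0 τ)) := by
    have hpow : MemLp (fun t : ℝ => t ^ (-(1 / 16) : ℝ)) 4 (volume.restrict (Ioo 0 τ)) := by
      rw [← integrable_norm_rpow_iff (by fun_prop) (by norm_num) (by norm_num)]
      have := (intervalIntegral.integrableOn_Ioo_rpow_iff (s := -(1 / 4)) hτ).2 (by norm_num)
      refine this.congr_fun (fun t ht => ?_) measurableSet_Ioo
      have ht0 : 0 < t := ht.1
      simp only
      rw [Real.norm_of_nonneg (by positivity), ← Real.rpow_mul ht0.le]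
      norm_num
    refine MemLp.of_le_mul hpow hmeas (c := K * ‖u₀‖) ?_
    filter_upwards [ae_restrict_mem measurableSet_Ioo] with t ht
    have ht0 : 0 < t := ht.1
    rw [Real.norm_of_nonneg (by positivity)]
    refine (hb t ht0 ht.2.le u₀).trans_eq (by ring)
  have hr : Represents l τ (hm.toLp _) (fun t => S b l c t u₀) := by
    rw [Represents]
    filter_upwards [hm.coeFn_toLp, ae_restrict_mem measurableSet_Ioo] with t ht htI
    rw [ht]
    exact S4_coe hl hc htI.1 u₀
  rw [toE_eq hr]
  exact hm.coeFn_toLp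

/-- The integral `∫₀ᵗ S(t - s) G₀(u(s)) ds` in `L⁴(I)`. -/
def duhamel (b : TestClass) (l c : ℝ) (u : ℝ → V b l) (t : ℝ) : L4 l :=
  ∫ s in Ioo 0 t, S4 b l c (t - s) (G0 b l c (u s))

theorem integrableOn_rpow_sub {t r : ℝ} (ht : 0 < t) (hr : -1 < r) :
    IntegrableOn (fun s => (t - s) ^ r) (Ioo 0 t) := by
  have h1 : IntervalIntegrable (fun s : ℝ => s ^ r) volume (t - 0) (t - t) :=
    intervalIntegral.intervalIntegrable_rpow' hr
  have h2 := h1.comp_sub_left t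
  simp only [sub_sub_cancel] at h2
  rw [intervalIntegrable_iff_integrableOn_Ioo_of_le ht.le] at h2
  exact h2

theorem integrableOn_duhamel (hl : 0 < l) (hc : StrictlyNegative b l c) {u : ℝ → V b l} {t : ℝ}
    (ht : 0 < t) (hu : ContinuousOn u (Icc 0 t)) :
    IntegrableOn (fun s => S4 b l c (t - s) (G0 b l c (u s))) (Ioo 0 t) := by
  obtain ⟨K, hK, hb⟩ := exists_norm_S4_le hl hc ht
  have hG : ContinuousOn (fun s => G0 b l c (u s)) (Icc 0 t) :=
    (continuous_G0 b l c).comp_continuousOn hu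
  obtain ⟨M, hM⟩ := isCompact_Icc.exists_bound_of_continuousOn hG
  have hcont : ContinuousOn (fun s => S4 b l c (t - s) (G0 b l c (u s))) (Ioo 0 t) := by
    refine (continuousOn_S4 hl hc).comp (f := fun s => (t - s, G0 b l c (u s))) ?_ ?_
    · exact (by fun_prop : Continuous fun s : ℝ => t - s).continuousOn.prodMk
        (hG.mono Ioo_subset_Icc_self)
    · intro s hs
      exact ⟨by simpa using hs.2, mem_univ _⟩
  refine Integrable.mono' ((integrableOn_rpow_sub (r := -(1 / 16)) ht (by norm_num)).const_mul
    (K * M)) (hcont.aestronglyMeasurable measurableSet_Ioo) ?_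
  filter_upwards [ae_restrict_mem measurableSet_Ioo] with s hs
  have hs0 : 0 < t - s := sub_pos.2 hs.2
  refine (hb (t - s) hs0 (by linarith [hs.1]) _).trans ?_
  have := hM s (Ioo_subset_Icc_self hs)
  calc _ ≤ K * (t - s) ^ (-(1 / 16) : ℝ) * M := by gcongr
    _ = _ := by ring

/-- The Bochner integrals in `L⁴(I)` and in `H` agree. -/
theorem duhamel_coe (hl : 0 < l) (hc : StrictlyNegative b l c) {u : ℝ → V b l} {t : ℝ}
    (ht : 0 < t) (hu : ContinuousOn u (Icc 0 t)) :
    ⇑(duhamel b l c u t) =ᵐ[muI l] F0curve b l c u t := by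
  obtain ⟨ι, hι⟩ := exists_embH l
  have : F0curve b l c u t = ι (duhamel b l c u t) := by
    rw [F0curve, duhamel, intervalIntegral.integral_of_le ht.le, integral_Ioc_eq_integral_Ioo,
      ← ι.integral_comp_comm (integrableOn_duhamel hl hc ht hu)]
    refine setIntegral_congr_fun measurableSet_Ioo fun s hs => ?_
    exact Lp.ext ((S4_coe hl hc (sub_pos.2 hs.2) _).symm.trans (hι _).symm)
  rw [this]
  exact (hι _).symm

theorem aestronglyMeasurable_duhamel (hl : 0 < l) (hc : StrictlyNegative b l c) {u : ℝ → V b l}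
    {τ : ℝ} (hu : ContinuousOn u (Icc 0 τ)) :
    AEStronglyMeasurable (duhamel b l c u) (volume.restrict (Ioo 0 τ)) := by
  let Δ : Set (ℝ × ℝ) := {p | 0 < p.2 ∧ p.2 < p.1 ∧ p.1 < τ}
  have hΔ : MeasurableSet Δ :=
    ((isOpen_lt continuous_const continuous_snd).inter
      ((isOpen_lt continuous_snd continuous_fst).inter
        (isOpen_lt continuous_fst continuous_const))).measurableSet
  let k : ℝ × ℝ → L4 l := fun p => S4 b l c (p.1 - p.2) (G0 b l c (u p.2))
  have hk : ContinuousOn k Δ := by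
    refine (continuousOn_S4 hl hc).comp (f := fun p : ℝ × ℝ => (p.1 - p.2, G0 b l c (u p.2)))
      ?_ ?_
    · refine (by fun_prop : Continuous fun p : ℝ × ℝ => p.1 - p.2).continuousOn.prodMk ?_
      refine (continuous_G0 b l c).comp_continuousOn (hu.comp continuous_snd.continuousOn ?_)
      exact fun p hp => ⟨hp.1.le, (hp.2.1.trans hp.2.2).le⟩
    · exact fun p hp => ⟨sub_pos.2 hp.2.1, mem_univ _⟩
  have hkm : AEStronglyMeasurable (Δ.indicator k) (volume.prod volume) :=
    (aestronglyMeasurable_indicator_iff hΔ).2 (hk.aestronglyMeasurable hΔ)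
  have h1 := hkm.integral_prod_right'
  refine (h1.mono_measure Measure.restrict_le_self).congr ?_
  filter_upwards [ae_restrict_mem measurableSet_Ioo] with t ht
  rw [duhamel, ← integral_indicator measurableSet_Ioo]
  congr 1
  ext1 s
  by_cases hs : s ∈ Ioo 0 t
  · rw [indicator_of_mem hs, indicator_of_mem (show (t, s) ∈ Δ from ⟨hs.1, hs.2, ht.2⟩)]
  · rw [indicator_of_notMem hs, indicator_of_notMem (fun h : (t, s) ∈ Δ => hs ⟨h.1, h.2.1⟩)]

/-- Restriction of `z ∈ E` to the time interval `(0, t)`. -/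
def resL (l τ t : ℝ) :
    E l τ →L[ℝ] Lp (L4 l) 4 ((volume.restrict (Ioo (0 : ℝ) τ)).restrict (Ioo 0 t)) :=
  LpToLpRestrictCLM ℝ (L4 l) ℝ (volume.restrict (Ioo (0 : ℝ) τ)) 4 (Ioo 0 t)

theorem norm_resL_le {τ t : ℝ} (z : E l τ) : ‖resL l τ t z‖ ≤ ‖z‖ :=
  norm_Lp_toLp_restrict_le _ _

theorem restrict_Ioo_Ioo {τ t : ℝ} (h : t ≤ τ) :
    (volume.restrict (Ioo (0 : ℝ) τ)).restrict (Ioo 0 t) = volume.restrict (Ioo 0 t) := by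
  rw [Measure.restrict_restrict measurableSet_Ioo,
    inter_eq_left.2 (Ioo_subset_Ioo_right h)]

theorem norm_resL {τ t : ℝ} (h : t ≤ τ) (z : E l τ) :
    ‖resL l τ t z‖ = (eLpNorm z 4 (volume.restrict (Ioo 0 t))).toReal := by
  rw [Lp.norm_def, ← restrict_Ioo_Ioo h]
  congr 1
  exact eLpNorm_congr_ae (LpToLpRestrictCLM_coeFn ℝ (Ioo 0 t) z)

theorem memLp_restrict {τ t : ℝ} (h : t ≤ τ) (z : E l τ) :
    MemLp z 4 (volume.restrict (Ioo 0 t)) := by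
  rw [← restrict_Ioo_Ioo h]
  exact (Lp.memLp z).restrict _

theorem eLpNorm_rpow_sub {t : ℝ} (ht : 0 < t) :
    MemLp (fun s => (t - s) ^ (-(5 / 16) : ℝ)) 2 (volume.restrict (Ioo 0 t)) ∧
    (eLpNorm (fun s => (t - s) ^ (-(5 / 16) : ℝ)) 2 (volume.restrict (Ioo 0 t))).toReal =
      (t ^ ((3 / 8) : ℝ) / (3 / 8)) ^ ((1 / 2) : ℝ) := by
  have hmeas : AEStronglyMeasurable (fun s : ℝ => (t - s) ^ (-(5 / 16) : ℝ))
    (volume.restrict (Ioo 0 t)) :=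
    ((measurable_const.sub measurable_id).pow_const _).aestronglyMeasurable
  have he : ∀ s ∈ Ioo 0 t, ‖(t - s) ^ (-(5 / 16) : ℝ)‖ ^ (2 : ℝ≥0∞).toReal =
      (t - s) ^ (-(5 / 8) : ℝ) := by
    intro s hs
    have h0 : 0 < t - s := sub_pos.2 hs.2
    rw [Real.norm_of_nonneg (by positivity), ← Real.rpow_mul h0.le]
    norm_num
  have hm : MemLp (fun s => (t - s) ^ (-(5 / 16) : ℝ)) 2 (volume.restrict (Ioo 0 t)) := by
    rw [← integrable_norm_rpow_iff hmeas (by norm_num) (by norm_num)]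
    exact (integrableOn_rpow_sub (r := -(5 / 8)) ht (by norm_num)).congr_fun
      (fun s hs => (he s hs).symm) measurableSet_Ioo
  refine ⟨hm, ?_⟩
  have hI : ∫ s in Ioo 0 t, ‖(t - s) ^ (-(5 / 16) : ℝ)‖ ^ (2 : ℝ≥0∞).toReal =
      t ^ ((3 / 8) : ℝ) / (3 / 8) := by
    rw [setIntegral_congr_fun measurableSet_Ioo he, ← integral_Ioc_eq_integral_Ioo,
      ← intervalIntegral.integral_of_le ht.le,
      intervalIntegral.integral_comp_sub_left (fun s : ℝ => s ^ (-(5 / 8) : ℝ)) t,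
      integral_rpow (Or.inl (by norm_num))]
    norm_num
  rw [hm.eLpNorm_eq_integral_rpow_norm (by norm_num) (by norm_num), hI,
    ENNReal.toReal_ofReal (by positivity)]
  norm_num

/-- `u ↦ ∫₀ᵗ S(t - s) G₀(u(s)) ds` is locally Lipschitz from `L⁴(0, t; L⁴(I))` to `L⁴(I)`. -/
theorem exists_norm_duhamel_sub_le (hl : 0 < l) (hc : StrictlyNegative b l c) {T : ℝ}
    (hT : 0 < T) : ∃ K > 0, ∀ τ, τ ≤ T → ∀ (z z' : E l τ) (u u' : ℝ → V b l),
      IsC1Curve b l τ z u → IsC1Curve b l τ z' u' → ∀ t ∈ Ioo 0 τ,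
      ‖duhamel b l c u t - duhamel b l c u' t‖ ≤
        K * (‖resL l τ t (z - z')‖ * (‖resL l τ t (z + z')‖ + 1)) := by
  obtain ⟨K, hK, hb⟩ := exists_norm_S4_G0_sub_le hl hc hT
  refine ⟨K * ((T ^ ((3 / 8) : ℝ) / (3 / 8)) ^ ((1 / 2) : ℝ) * (1 + T ^ ((1 / 4) : ℝ))),
    by positivity, fun τ hτ z z' u u' hz hz' t ht => ?_⟩
  have ht0 : 0 < t := ht.1
  have htτ : t ≤ τ := ht.2.le
  have hI := integrableOn_duhamel hl hc ht0 (hz.1.continuousOn.mono (Icc_subset_Icc_right htτ))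
  have hI' := integrableOn_duhamel hl hc ht0 (hz'.1.continuousOn.mono (Icc_subset_Icc_right htτ))
  obtain ⟨hm, hmn⟩ := eLpNorm_rpow_sub ht0
  have hd := (memLp_restrict htτ (z - z')).norm
  have hs := (memLp_restrict htτ (z + z')).norm
  have h1 : MemLp (fun _ : ℝ => (1 : ℝ)) 4 (volume.restrict (Ioo 0 t)) := memLp_const 1
  obtain ⟨hint, hle⟩ := integral_mul_mul_le hm hd (hs.add h1)
  have hrep : ∀ᵐ s ∂(volume.restrict (Ioo 0 t)),
      embV b l (u s) = z s ∧ embV b l (u' s) = z' s ∧ (z - z') s = z s - z' s ∧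
      (z + z') s = z s + z' s := by
    have : ∀ᵐ s ∂(volume.restrict (Ioo 0 τ)),
        embV b l (u s) = z s ∧ embV b l (u' s) = z' s ∧ (z - z') s = z s - z' s ∧
        (z + z') s = z s + z' s := by
      filter_upwards [hz.2, hz'.2, Lp.coeFn_sub z z', Lp.coeFn_add z z'] with s a1 a2 a3 a4
      exact ⟨Lp.ext ((embV_coe _).trans a1.symm), Lp.ext ((embV_coe _).trans a2.symm), a3, a4⟩
    exact ae_mono (Measure.restrict_mono (Ioo_subset_Ioo_right htτ) le_rfl) this
  have hone : (eLpNorm (fun _ : ℝ => (1 : ℝ)) 4 (volume.restrict (Ioo 0 t))).toReal ≤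
      T ^ ((1 / 4) : ℝ) := by
    have : (eLpNorm (fun _ : ℝ => (1 : ℝ)) 4 (volume.restrict (Ioo 0 t))).toReal =
        t ^ ((1 / 4) : ℝ) := by
      rw [h1.eLpNorm_eq_integral_rpow_norm (by norm_num) (by norm_num),
        ENNReal.toReal_ofReal (by positivity)]
      simp [ht0.le]
    rw [this]
    exact Real.rpow_le_rpow ht0.le (htτ.trans hτ) (by norm_num)
  have hsum : (eLpNorm (fun s => ‖(z + z') s‖ + 1) 4 (volume.restrict (Ioo 0 t))).toReal ≤
      ‖resL l τ t (z + z')‖ + T ^ ((1 / 4) : ℝ) := by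
    have h2 := eLpNorm_add_le hs.aestronglyMeasurable h1.aestronglyMeasurable
      (p := 4) (by norm_num)
    have h3 := ENNReal.toReal_mono (ENNReal.add_ne_top.2 ⟨hs.eLpNorm_ne_top, h1.eLpNorm_ne_top⟩) h2
    rw [ENNReal.toReal_add hs.eLpNorm_ne_top h1.eLpNorm_ne_top, eLpNorm_norm,
      ← norm_resL htτ] at h3
    exact h3.trans (by gcongr)
  have hbound : ‖duhamel b l c u t - duhamel b l c u' t‖ ≤
      ∫ s in Ioo 0 t, K * ((t - s) ^ (-(5 / 16) : ℝ) *
        (‖(z - z') s‖ * (‖(z + z') s‖ + 1))) := by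
    rw [duhamel, duhamel, ← integral_sub hI hI']
    refine norm_integral_le_of_norm_le (hint.const_mul K) ?_
    filter_upwards [hrep, ae_restrict_mem measurableSet_Ioo] with s ⟨a1, a2, a3, a4⟩ hs
    have hs0 : 0 < t - s := sub_pos.2 hs.2
    rw [← S4_sub hl hc hs0, a3, a4, ← a1, ← a2]
    refine (hb (t - s) hs0 (by linarith [hs.1]) (u s) (u' s)).trans_eq (by ring)
  refine hbound.trans ?_
  rw [integral_const_mul, mul_assoc]
  gcongr
  refine hle.trans ?_
  rw [hmn, eLpNorm_norm, ← norm_resL htτ, mul_assoc]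
  have htT : t ^ ((3 / 8) : ℝ) ≤ T ^ ((3 / 8) : ℝ) :=
    Real.rpow_le_rpow ht0.le (htτ.trans hτ) (by norm_num)
  have hT4 : 0 ≤ T ^ ((1 / 4) : ℝ) := by positivity
  set N := ‖resL l τ t (z + z')‖ with hN
  have hN0 : 0 ≤ N := norm_nonneg _
  calc _ ≤ (T ^ ((3 / 8) : ℝ) / (3 / 8)) ^ ((1 / 2) : ℝ) *
        (‖resL l τ t (z - z')‖ * (N + T ^ ((1 / 4) : ℝ))) := by
        gcongr
        exact hsum
    _ ≤ (T ^ ((3 / 8) : ℝ) / (3 / 8)) ^ ((1 / 2) : ℝ) *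
        (‖resL l τ t (z - z')‖ * ((1 + T ^ ((1 / 4) : ℝ)) * (N + 1))) := by
        gcongr
        nlinarith
    _ = _ := by ring

end

/-! ### Density of `C¹([0, T]; V)` in `E` and the extension of `F₀` -/

section

variable {b : TestClass} {l c : ℝ}

theorem IsTest.of_compactSupport {φ : ℝ → ℝ} (h : IsTest .compactSupport l φ) :
    IsTest b l φ := by
  cases b with
  | compactSupport => exact h
  | vanishing => exact ⟨h.1, h.eq_zero⟩

/-- Test functions are dense in `L⁴(I)`: a smooth approximation is cut off near the end points. -/
theorem dense_test_L4 (hl : 0 < l) :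
    Dense {a : L4 l | ∃ φ, IsTest b l φ ∧ ⇑a =ᵐ[muI l] φ} := by
  have : IsFiniteMeasureOnCompacts (muI l) := ⟨fun _ _ => measure_lt_top _ _⟩
  have hd := Lp.dense_hasCompactSupport_contDiff (E := ℝ) (F := ℝ) (μ := muI l) (p := 4)
    (by norm_num)
  intro a
  refine closure_minimal ?_ isClosed_closure (hd a)
  rintro f ⟨g, hfg, -, hg⟩
  have hpos : ∀ n : ℕ, 0 < l / (n + 2) ∧ l / (n + 2) < l ∧ l / (n + 3) < l / (n + 2) := by
    intro n
    refine ⟨by positivity, div_lt_self hl (by linarith [n.cast_nonneg (α := ℝ)]), ?_⟩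
    gcongr
    norm_num
  let χ : ℕ → ContDiffBump (0 : ℝ) := fun n =>
    { rIn := l - l / (n + 2)
      rOut := l - l / (n + 3)
      rIn_pos := by linarith [(hpos n).2.1]
      rIn_lt_rOut := by linarith [(hpos n).2.2] }
  have hχ : ∀ n, Continuous (fun x => g x * χ n x) := fun n =>
    hg.continuous.mul (χ n).continuous
  have hm : ∀ n, MemLp (fun x => g x * χ n x) 4 (muI l) := fun n =>
    memLp_muI_of_continuous (hχ n) 4
  have htest : ∀ n, IsTest b l (fun x => g x * χ n x) := by
    intro n
    refine IsTest.of_compactSupport ⟨hg.mul (χ n).contDiff, (χ n).hasCompactSupport.mul_left, ?_⟩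
    have h1 : tsupport (fun x => g x * χ n x) ⊆ tsupport (χ n) := tsupport_mul_subset_right
    refine h1.trans ?_
    rw [(χ n).tsupport_eq, Real.closedBall_eq_Icc]
    have h3 : 0 < l / ((n : ℝ) + 3) := by positivity
    refine Icc_subset_Ioo ?_ ?_
    · simp only [χ]; linarith
    · simp only [χ]; linarith
  refine mem_closure_of_tendsto (f := fun n => (hm n).toLp _) (b := atTop) ?_
    (.of_forall fun n => ⟨_, htest n, (hm n).coeFn_toLp⟩)
  rw [tendsto_iff_norm_sub_tendsto_zero]
  have hpow : Tendsto (fun n => ‖(hm n).toLp _ - f‖ ^ 4) atTop (𝓝 0) := by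
    have he : ∀ n, ‖(hm n).toLp _ - f‖ ^ 4 = ∫ x, ‖g x * χ n x - g x‖ ^ 4 ∂(muI l) := by
      intro n
      rw [norm_pow_four]
      refine integral_congr_ae ?_
      filter_upwards [Lp.coeFn_sub ((hm n).toLp _) f, (hm n).coeFn_toLp, hfg] with x h1 h2 h3
      rw [h1, Pi.sub_apply, h2, h3]
    simp only [he]
    have hlim := tendsto_integral_of_dominated_convergence (μ := muI l) (f := fun _ => (0 : ℝ))
      (F := fun n x => ‖g x * χ n x - g x‖ ^ 4) (fun x => ‖g x‖ ^ 4)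
      (fun n => (((hχ n).sub hg.continuous).norm.pow 4).aestronglyMeasurable)
      (memLp_one_iff_integrable.1 (memLp_muI_of_continuous (hg.continuous.norm.pow 4) 1))
      (fun n => .of_forall fun x => ?_) ?_
    · simpa using hlim
    · have h0 := (χ n).nonneg' x
      have h1 := (χ n).le_one (x := x)
      rw [Real.norm_of_nonneg (by positivity), ← mul_sub_one, norm_mul]
      gcongr
      refine mul_le_of_le_one_right (norm_nonneg _) ?_
      rw [Real.norm_eq_abs, abs_le]
      constructor <;> linarith
    · filter_upwards [ae_restrict_mem measurableSet_Ioo] with x hx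
      have hev : ∀ᶠ n : ℕ in atTop, |x| ≤ l - l / (n + 2) := by
        have h1 : Tendsto (fun n : ℕ => l - l / ((n : ℝ) + 2)) atTop (𝓝 (l - 0)) :=
          tendsto_const_nhds.sub (tendsto_const_nhds.div_atTop
            (tendsto_atTop_add_const_right _ _ tendsto_natCast_atTop_atTop))
        rw [sub_zero] at h1
        exact h1.eventually_const_le (abs_lt.2 hx)
      refine tendsto_const_nhds.congr' ?_
      filter_upwards [hev] with n hn
      rw [(χ n).one_of_mem_closedBall (by simpa [χ] using hn)]
      simp
  have h4 : Tendsto (fun n => (‖(hm n).toLp _ - f‖ ^ 4) ^ ((4 : ℕ)⁻¹ : ℝ)) atTop (𝓝 0) := by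
    have := hpow.rpow_const (p := ((4 : ℕ)⁻¹ : ℝ)) (Or.inr (by positivity))
    rwa [Real.zero_rpow (by norm_num)] at this
  refine h4.congr fun n => ?_
  exact Real.pow_rpow_inv_natCast (norm_nonneg _) (by norm_num)

theorem dense_C1V (hl : 0 < l) (τ : ℝ) : Dense (C1V b l τ) := by
  have hadd : ∀ z ∈ C1V b l τ, ∀ z' ∈ C1V b l τ, z + z' ∈ C1V b l τ := by
    rintro z ⟨u, hu, hr⟩ z' ⟨u', hu', hr'⟩
    refine ⟨fun t => u t + u' t, hu.add hu', ?_⟩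
    rw [Represents]
    filter_upwards [hr, hr', Lp.coeFn_add z z'] with t h1 h2 h3
    rw [h3, Pi.add_apply]
    exact (Lp.coeFn_add _ _).trans ((h1.add h2).trans (Lp.coeFn_add _ _).symm)
  -- The products `g(t) a(x)`, as a bounded bilinear function of `a` and `g`.
  let B : L4 l →L[ℝ] ℝ →L[ℝ] L4 l := (ContinuousLinearMap.lsmul ℝ ℝ).flip
  let Φ : L4 l →L[ℝ] Lp ℝ 4 (volume.restrict (Ioo 0 τ)) →L[ℝ] E l τ := B.compLpL₂ 4 _
  have hΦ : ∀ a g, ⇑(Φ a g) =ᵐ[volume.restrict (Ioo 0 τ)] fun t => g t • a := fun a g =>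
    (B a).coeFn_compLp g
  have hprod : ∀ (a : L4 l), (∃ φ, IsTest b l φ ∧ ⇑a =ᵐ[muI l] φ) →
      ∀ g, Φ a g ∈ closure (C1V b l τ) := by
    rintro a ⟨φ, hφ, ha⟩ g
    have hd := Lp.dense_hasCompactSupport_contDiff (E := ℝ) (F := ℝ)
      (μ := volume.restrict (Ioo 0 τ)) (p := 4) (by norm_num)
    refine map_mem_closure (Φ a).continuous (hd g) ?_
    rintro f ⟨k, hk, -, hkc⟩
    obtain ⟨U, hU⟩ := exists_testTuple (b := b) 1 hφ
    let v : V b l := ⟨U, hU.mem_H0⟩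
    refine ⟨fun t => k t • v, ?_, ?_⟩
    · exact ((hkc.of_le (by exact_mod_cast le_top)).smul contDiff_const).contDiffOn
    · rw [Represents]
      filter_upwards [hk, hΦ a f] with t h1 h2
      rw [h2, h1]
      refine (Lp.coeFn_smul _ _).trans (EventuallyEq.trans ?_ (Lp.coeFn_smul (k t) (v.1 0)).symm)
      have hv : ⇑(v.1 0) =ᵐ[muI l] φ := by simpa using hU.2 0
      exact (ha.trans hv.symm).const_smul (k t)
  intro z
  refine Lp.induction (p := 4) (by norm_num) (motive := fun z : E l τ => z ∈ closure (C1V b l τ))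
    ?_ ?_ isClosed_closure z
  · intro a s hs hμs
    let g : Lp ℝ 4 (volume.restrict (Ioo 0 τ)) := indicatorConstLp 4 hs hμs.ne (1 : ℝ)
    have he : (Lp.simpleFunc.indicatorConst 4 hs hμs.ne a : E l τ) = Φ.flip g a := by
      rw [Lp.simpleFunc.coe_indicatorConst]
      refine Lp.ext ?_
      have hg : ⇑g =ᵐ[_] _ := indicatorConstLp_coeFn
      have ha : ⇑(indicatorConstLp 4 hs hμs.ne a) =ᵐ[_] _ := indicatorConstLp_coeFn
      filter_upwards [hg, ha, hΦ a g] with t h1 h2 h3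
      rw [h2, ContinuousLinearMap.flip_apply, h3, h1]
      by_cases ht : t ∈ s <;> simp [ht]
    rw [he, ← closure_closure]
    exact map_mem_closure (Φ.flip g).continuous (dense_test_L4 (b := b) hl a)
      fun a ha => hprod a ha g
  · intro f g hf hg _ h1 h2
    exact map_mem_closure₂ continuous_add h1 h2 fun z hz z' hz' => hadd z hz z' hz'

theorem isC1Curve_zero (τ : ℝ) : IsC1Curve b l τ 0 fun _ => 0 := by
  refine ⟨contDiffOn_const, ?_⟩
  rw [Represents]
  filter_upwards [Lp.coeFn_zero (L4 l) 4 (volume.restrict (Ioo 0 τ))] with t ht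
  rw [ht]
  exact (Lp.coeFn_zero _ _ _).trans (Lp.coeFn_zero _ _ _).symm

theorem duhamel_zero (hl : 0 < l) (hc : StrictlyNegative b l c) (t : ℝ) :
    duhamel b l c (fun _ => 0) t = 0 := by
  have hG : G0 b l c (0 : V b l) = 0 := by
    rw [G0_eq]
    simp
  rw [duhamel]
  refine setIntegral_eq_zero_of_forall_eq_zero fun s hs => ?_
  have := S4_smul hl hc (sub_pos.2 hs.2) 0 (0 : H l)
  rw [hG]
  simpa using this

/-- Whichever curve `F₀` chooses to represent `z`, the bound for the Duhamel integral makes it an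
element of `E`, so that `toE` does not return its default value. -/
theorem exists_F0_ae_eq (hl : 0 < l) (hc : StrictlyNegative b l c) {τ : ℝ} (hτ : 0 < τ) {z : E l τ}
    (hz : z ∈ C1V b l τ) : ∃ u, IsC1Curve b l τ z u ∧
      ∀ᵐ t ∂(volume.restrict (Ioo 0 τ)), F0 b l c τ z t = duhamel b l c u t := by
  have hz' : ∃ u, IsC1Curve b l τ z u := hz
  refine ⟨hz'.choose, hz'.choose_spec, ?_⟩
  rw [F0, dif_pos hz']
  have hu := hz'.choose_spec
  set u := hz'.choose
  obtain ⟨K, hK, hb⟩ := exists_norm_duhamel_sub_le hl hc hτ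
  have hm : MemLp (duhamel b l c u) 4 (volume.restrict (Ioo 0 τ)) := by
    refine MemLp.of_bound (aestronglyMeasurable_duhamel hl hc hu.1.continuousOn)
      (K * (‖z‖ * (‖z‖ + 1))) ?_
    filter_upwards [ae_restrict_mem measurableSet_Ioo] with t ht
    have := hb τ le_rfl z 0 u _ hu (isC1Curve_zero τ) t ht
    rw [duhamel_zero hl hc, sub_zero, sub_zero, add_zero] at this
    refine this.trans ?_
    have := norm_resL_le (t := t) z
    gcongr
  have hr : Represents l τ (hm.toLp _) (F0curve b l c u) := by
    rw [Represents]
    filter_upwards [hm.coeFn_toLp, ae_restrict_mem measurableSet_Ioo] with t h1 ht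
    rw [h1]
    exact duhamel_coe hl hc ht.1 (hu.1.continuousOn.mono (Icc_subset_Icc_right ht.2.le))
  rw [toE_eq hr]
  exact hm.coeFn_toLp

theorem exists_F0_sub_ae_le (hl : 0 < l) (hc : StrictlyNegative b l c) {T : ℝ} (hT : 0 < T) :
    ∃ K > 0, ∀ τ, 0 < τ → τ ≤ T → ∀ z ∈ C1V b l τ, ∀ z' ∈ C1V b l τ,
      ∀ᵐ t ∂(volume.restrict (Ioo 0 τ)), ‖F0 b l c τ z t - F0 b l c τ z' t‖ ≤
        K * (‖resL l τ t (z - z')‖ * (‖resL l τ t (z + z')‖ + 1)) := by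
  obtain ⟨K, hK, hb⟩ := exists_norm_duhamel_sub_le hl hc hT
  refine ⟨K, hK, fun τ hτ hτT z hz z' hz' => ?_⟩
  obtain ⟨u, hu, h1⟩ := exists_F0_ae_eq hl hc hτ hz
  obtain ⟨u', hu', h2⟩ := exists_F0_ae_eq hl hc hτ hz'
  filter_upwards [h1, h2, ae_restrict_mem measurableSet_Ioo] with t h1 h2 ht
  rw [h1, h2]
  exact hb τ hτT z z' u u' hu hu' t ht

/-- `F` is the limit of `F₀`, since `F₀` is locally Lipschitz and `C1V` is dense. -/
theorem tendsto_F0 (hl : 0 < l) (hc : StrictlyNegative b l c) {τ : ℝ} (hτ : 0 < τ) (z : E l τ) :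
    Tendsto (F0 b l c τ) (𝓝[C1V b l τ] z) (𝓝 (F b l c τ z)) := by
  refine tendsto_extendFrom ?_
  obtain ⟨K, hK, hb⟩ := exists_F0_sub_ae_le hl hc hτ
  have hne : (𝓝[C1V b l τ] z).NeBot := mem_closure_iff_nhdsWithin_neBot.1 (dense_C1V hl τ z)
  have hcau : Cauchy (map (F0 b l c τ) (𝓝[C1V b l τ] z)) := by
    rw [cauchy_map_iff, and_iff_right hne, tendsto_uniformity_iff_dist_tendsto_zero]
    let κ : ℝ := (measureUnivNNReal (volume.restrict (Ioo (0 : ℝ) τ)) : ℝ) ^ ((4 : ℝ≥0∞).toReal)⁻¹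
    have hle : ∀ᶠ p : E l τ × E l τ in 𝓝[C1V b l τ] z ×ˢ 𝓝[C1V b l τ] z,
        dist (F0 b l c τ p.1) (F0 b l c τ p.2) ≤
          κ * (K * (‖p.1 - p.2‖ * (‖p.1 + p.2‖ + 1))) := by
      filter_upwards [prod_mem_prod self_mem_nhdsWithin self_mem_nhdsWithin] with p hp
      rw [dist_eq_norm]
      refine Lp.norm_le_of_ae_bound (by positivity) ?_
      filter_upwards [hb τ hτ le_rfl p.1 hp.1 p.2 hp.2,
        Lp.coeFn_sub (F0 b l c τ p.1) (F0 b l c τ p.2)] with t h1 h2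
      rw [h2, Pi.sub_apply]
      refine h1.trans ?_
      have h3 := norm_resL_le (t := t) (p.1 - p.2)
      have h4 := norm_resL_le (t := t) (p.1 + p.2)
      gcongr
    refine squeeze_zero' (.of_forall fun _ => dist_nonneg) hle ?_
    have hc : Continuous fun p : E l τ × E l τ =>
        κ * (K * (‖p.1 - p.2‖ * (‖p.1 + p.2‖ + 1))) := by fun_prop
    have := hc.tendsto (z, z)
    simp only [sub_self, norm_zero, zero_mul, mul_zero] at this
    rw [nhds_prod_eq] at this
    exact this.mono_left (Filter.prod_mono nhdsWithin_le_nhds nhdsWithin_le_nhds)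
  exact cauchy_map_iff_exists_tendsto.1 hcau

/-- The local Lipschitz estimate for `F`, pointwise in time and causal. -/
theorem exists_F_sub_ae_le (hl : 0 < l) (hc : StrictlyNegative b l c) {T : ℝ} (hT : 0 < T) :
    ∃ K > 0, ∀ τ, 0 < τ → τ ≤ T → ∀ z z' : E l τ,
      ∀ᵐ t ∂(volume.restrict (Ioo 0 τ)), ‖F b l c τ z t - F b l c τ z' t‖ ≤
        K * (‖resL l τ t (z - z')‖ * (‖resL l τ t (z + z')‖ + 1)) := by
  obtain ⟨K, hK, hb⟩ := exists_F0_sub_ae_le hl hc hT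
  refine ⟨K, hK, fun τ hτ hτT z z' => ?_⟩
  obtain ⟨x, hx, hxz⟩ := mem_closure_iff_seq_limit.1 (dense_C1V (b := b) hl τ z)
  obtain ⟨x', hx', hxz'⟩ := mem_closure_iff_seq_limit.1 (dense_C1V (b := b) hl τ z')
  have h1 : Tendsto (fun n => F0 b l c τ (x n)) atTop (𝓝 (F b l c τ z)) :=
    (tendsto_F0 hl hc hτ z).comp (tendsto_nhdsWithin_iff.2 ⟨hxz, .of_forall hx⟩)
  have h2 : Tendsto (fun n => F0 b l c τ (x' n)) atTop (𝓝 (F b l c τ z')) :=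
    (tendsto_F0 hl hc hτ z').comp (tendsto_nhdsWithin_iff.2 ⟨hxz', .of_forall hx'⟩)
  obtain ⟨ns, hns, hae⟩ := (tendstoInMeasure_of_tendsto_Lp (h1.sub h2)).exists_seq_tendsto_ae
  have hall : ∀ᵐ t ∂(volume.restrict (Ioo 0 τ)), ∀ n,
      ‖(F0 b l c τ (x n) - F0 b l c τ (x' n)) t‖ ≤
        K * (‖resL l τ t (x n - x' n)‖ * (‖resL l τ t (x n + x' n)‖ + 1)) := by
    rw [ae_all_iff]
    intro n
    filter_upwards [hb τ hτ hτT _ (hx n) _ (hx' n),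
      Lp.coeFn_sub (F0 b l c τ (x n)) (F0 b l c τ (x' n))] with t a1 a2
    rwa [a2]
  filter_upwards [hae, hall, Lp.coeFn_sub (F b l c τ z) (F b l c τ z')] with t a1 a2 a3
  rw [a3, Pi.sub_apply] at a1
  have hc : Continuous fun p : E l τ × E l τ =>
      K * (‖resL l τ t (p.1 - p.2)‖ * (‖resL l τ t (p.1 + p.2)‖ + 1)) := by fun_prop
  have hlim := ((hc.tendsto (z, z')).comp (hxz.prodMk_nhds hxz')).comp hns.tendsto_atTop
  exact le_of_tendsto_of_tendsto' a1.norm hlim fun n => a2 (ns n)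

end

/-! ### A Gronwall argument with continuation -/

theorem le_mul_exp_of_le_add_integral {D : ℝ → ℝ} (hD : Continuous D) {a β t₀ : ℝ} (ha : 0 ≤ a)
    (hβ : 0 ≤ β) (hnn : ∀ t ∈ Icc 0 t₀, 0 ≤ D t)
    (h : ∀ t ∈ Icc 0 t₀, D t ≤ a + β * ∫ s in (0 : ℝ)..t, D s) :
    ∀ t ∈ Icc 0 t₀, D t ≤ a * Real.exp (β * t) := by
  intro t ht
  let G : ℝ → ℝ := fun t => a + β * ∫ s in (0 : ℝ)..t, D s
  have hG : ∀ t, HasDerivAt G (β * D t) t := fun t =>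
    (((hD.integral_hasStrictDerivAt 0 t).hasDerivAt).const_mul β).const_add a
  have hG0 : ∀ t ∈ Icc 0 t₀, 0 ≤ G t := fun t ht => (hnn t ht).trans (h t ht)
  have := norm_le_gronwallBound_of_norm_deriv_right_le (f := G) (f' := fun t => β * D t) (δ := a)
    (K := β) (ε := 0) (a := 0) (b := t₀)
    (fun t _ => (hG t).continuousAt.continuousWithinAt) (fun t _ => (hG t).hasDerivWithinAt)
    (by simp [G, abs_of_nonneg ha])
    (fun s hs => by
      have hs' := Ico_subset_Icc_self hs
      rw [Real.norm_of_nonneg (mul_nonneg hβ (hnn s hs')), Real.norm_of_nonneg (hG0 s hs'),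
        add_zero]
      exact mul_le_mul_of_nonneg_left (h s hs') hβ) t ht
  rw [gronwallBound_ε0, Real.norm_of_nonneg (hG0 t ht), sub_zero] at this
  exact (h t ht).trans this

/-- Gronwall's inequality for a differential inequality that is known only as long as the solution
is at most `1`. Since the resulting bound stays below `1`, the solution never reaches `1`. -/
theorem integral_le_of_le_one_imp {φ α : ℝ → ℝ} (hφ : Integrable φ) (hφ0 : ∀ t, 0 ≤ φ t) {τ a β : ℝ}
    (hτ : 0 ≤ τ) (hα : IntervalIntegrable α volume 0 τ) (hα0 : ∀ t ∈ Ioo 0 τ, 0 ≤ α t)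
    (hαa : ∫ t in (0 : ℝ)..τ, α t ≤ a) (hβ : 0 ≤ β)
    (h : ∀ᵐ t ∂(volume.restrict (Ioo 0 τ)), ∫ s in (0 : ℝ)..t, φ s ≤ 1 →
      φ t ≤ α t + β * ∫ s in (0 : ℝ)..t, φ s)
    (ha1 : a * Real.exp (β * τ) < 1) :
    ∫ s in (0 : ℝ)..τ, φ s ≤ a * Real.exp (β * τ) := by
  set D : ℝ → ℝ := fun t => ∫ s in (0 : ℝ)..t, φ s with hDdef
  have hint : ∀ x y, IntervalIntegrable φ volume x y := fun x y => hφ.intervalIntegrable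
  have hD : Continuous D := intervalIntegral.continuous_primitive hint 0
  have hmono : Monotone D := by
    intro x y hxy
    have := intervalIntegral.integral_add_adjacent_intervals (hint 0 x) (hint x y)
    have h0 := intervalIntegral.integral_nonneg (f := φ) (μ := volume) hxy fun s _ => hφ0 s
    simp only [hDdef]
    linarith
  have hD0 : D 0 = 0 := by simp [hDdef]
  have hαint : ∀ t ∈ Icc 0 τ, IntervalIntegrable α volume 0 t := fun t ht =>
    hα.mono_set (by rw [uIcc_of_le ht.1, uIcc_of_le hτ]; exact Icc_subset_Icc_right ht.2)
  have hαle : ∀ t ∈ Icc 0 τ, ∫ s in (0 : ℝ)..t, α s ≤ a := by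
    intro t ht
    refine le_trans ?_ hαa
    rw [intervalIntegral.integral_of_le ht.1, intervalIntegral.integral_of_le hτ,
      integral_Ioc_eq_integral_Ioo, integral_Ioc_eq_integral_Ioo]
    refine setIntegral_mono_set ((intervalIntegrable_iff_integrableOn_Ioo_of_le hτ).1 hα) ?_
      (Ioo_subset_Ioo_right ht.2).eventuallyLE
    filter_upwards [ae_restrict_mem measurableSet_Ioo] with s hs using hα0 s hs
  have ha : 0 ≤ a := by simpa using hαle 0 ⟨le_rfl, hτ⟩
  have key : ∀ t₀ ∈ Icc 0 τ, D t₀ ≤ 1 → D t₀ ≤ a * Real.exp (β * t₀) := by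
    intro t₀ ht₀ h1
    refine le_mul_exp_of_le_add_integral hD ha hβ (fun t ht => hD0 ▸ hmono ht.1) ?_ t₀
      ⟨ht₀.1, le_rfl⟩
    intro t ht
    have htτ : t ∈ Icc 0 τ := ⟨ht.1, ht.2.trans ht₀.2⟩
    have hle : D t ≤ ∫ s in (0 : ℝ)..t, (α s + β * D s) := by
      refine intervalIntegral.integral_mono_ae_restrict ht.1 (hint 0 t)
        ((hαint t htτ).add ((hD.intervalIntegrable 0 t).const_mul β)) ?_
      rw [← restrict_Ioo_eq_restrict_Icc]
      have hsub := ae_mono (Measure.restrict_mono (Ioo_subset_Ioo_right htτ.2) le_rfl) h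
      filter_upwards [hsub, ae_restrict_mem measurableSet_Ioo] with s hs hsI
      exact hs ((hmono (hsI.2.le.trans ht.2)).trans h1)
    rw [intervalIntegral.integral_add (hαint t htτ) ((hD.intervalIntegrable 0 t).const_mul β),
      intervalIntegral.integral_const_mul] at hle
    linarith [hαle t htτ]
  rcases le_or_gt (D τ) 1 with h1 | h1
  · exact key τ ⟨hτ, le_rfl⟩ h1
  · obtain ⟨t₀, ht₀, he⟩ := intermediate_value_Icc hτ hD.continuousOn
      (show (1 : ℝ) ∈ Icc (D 0) (D τ) from ⟨by rw [hD0]; norm_num, h1.le⟩)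
    have h2 := key t₀ ht₀ he.le
    rw [he] at h2
    have h3 : a * Real.exp (β * t₀) ≤ a * Real.exp (β * τ) := by
      gcongr
      exact ht₀.2
    linarith

/-! ### Continuous dependence -/

section

variable {b : TestClass} {l c : ℝ}

theorem norm_resL_pow_four {τ t : ℝ} (h : t ≤ τ) (z : E l τ) :
    ‖resL l τ t z‖ ^ 4 = ∫ s in Ioo 0 t, ‖z s‖ ^ 4 := by
  rw [norm_pow_four, ← restrict_Ioo_Ioo h]
  refine integral_congr_ae ?_
  filter_upwards [LpToLpRestrictCLM_coeFn ℝ (Ioo 0 t) z] with s hs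
  exact congrArg (‖·‖ ^ 4) hs

/-- The difference of two solutions, pointwise in time, in terms of its own past. -/
theorem exists_solution_sub_ae_le (hl : 0 < l) (hc : StrictlyNegative b l c) {T : ℝ} (hT : 0 < T)
    (R : ℝ) : ∃ K > 0, ∃ L > 0, ∀ τ, 0 < τ → τ ≤ T → ∀ (u₀ u₁ : H l) (w₀ w₁ y₀ y₁ : E l τ),
      IsSolution b l c τ u₀ w₀ y₀ → IsSolution b l c τ u₁ w₁ y₁ → ‖y₀‖ ≤ R → ‖w₀‖ ≤ R →
      ‖w₀ - w₁‖ ≤ 1 → ∀ᵐ t ∂(volume.restrict (Ioo 0 τ)), ‖resL l τ t (y₀ - y₁)‖ ≤ 1 →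
        ‖(y₀ - y₁) t‖ ≤ K * t ^ (-(1 / 16) : ℝ) * ‖u₀ - u₁‖ +
          L * (‖resL l τ t (y₀ - y₁)‖ + ‖w₀ - w₁‖) := by
  obtain ⟨K, hK, hS⟩ := exists_norm_S4_le hl hc hT
  obtain ⟨K', hK', hF⟩ := exists_F_sub_ae_le hl hc hT
  refine ⟨K, hK, K' * (4 * |R| + 3), by positivity, ?_⟩
  intro τ hτ hτT u₀ u₁ w₀ w₁ y₀ y₁ h₀ h₁ hy hw hw1
  have hval : ∀ (u : H l) (w y : E l τ), IsSolution b l c τ u w y →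
      ∀ᵐ t ∂(volume.restrict (Ioo 0 τ)), y t = S4 b l c t u + F b l c τ (y + w) t := by
    intro u w y h
    have h' : y = toE l τ (fun t => S b l c t u) + F b l c τ (y + w) := h
    have h2 := Lp.coeFn_add (toE l τ fun t => S b l c t u) (F b l c τ (y + w))
    rw [← h'] at h2
    filter_upwards [h2, toE_S_ae hl hc hτ u] with t a1 a2
    rw [a1, Pi.add_apply, a2]
  filter_upwards [hval _ _ _ h₀, hval _ _ _ h₁, hF τ hτ hτT (y₀ + w₀) (y₁ + w₁),
    Lp.coeFn_sub y₀ y₁, ae_restrict_mem measurableSet_Ioo] with t a0 a1 a2 a3 ht hρ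
  set ρ := ‖resL l τ t (y₀ - y₁)‖ with hρdef
  set η := ‖w₀ - w₁‖ with hη
  have hR : R ≤ |R| := le_abs_self R
  have hn : ‖resL l τ t (y₀ + w₀ - (y₁ + w₁))‖ ≤ ρ + η := by
    have e : y₀ + w₀ - (y₁ + w₁) = (y₀ - y₁) + (w₀ - w₁) := by abel
    rw [e, map_add]
    exact (norm_add_le _ _).trans (add_le_add le_rfl (norm_resL_le _))
  have hp : ‖resL l τ t (y₀ + w₀ + (y₁ + w₁))‖ ≤ 4 * |R| + 2 := by
    have e : y₀ + w₀ + (y₁ + w₁) = (y₀ + w₀) + (y₀ + w₀) - (y₀ + w₀ - (y₁ + w₁)) := by abel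
    rw [e, map_sub, map_add]
    have h1 : ‖resL l τ t (y₀ + w₀)‖ ≤ 2 * |R| :=
      (norm_resL_le _).trans ((norm_add_le _ _).trans (by linarith))
    have h2 := norm_sub_le (resL l τ t (y₀ + w₀) + resL l τ t (y₀ + w₀))
      (resL l τ t (y₀ + w₀ - (y₁ + w₁)))
    have h3 := norm_add_le (resL l τ t (y₀ + w₀)) (resL l τ t (y₀ + w₀))
    linarith
  have e : (y₀ - y₁) t = S4 b l c t (u₀ - u₁) +
      (F b l c τ (y₀ + w₀) t - F b l c τ (y₁ + w₁) t) := by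
    rw [a3, Pi.sub_apply, a0, a1, S4_sub hl hc ht.1]
    abel
  rw [e]
  refine (norm_add_le _ _).trans (add_le_add (hS t ht.1 (ht.2.le.trans hτT) _) (a2.trans ?_))
  have hρ0 : 0 ≤ ρ := norm_nonneg _
  have hη0 : 0 ≤ η := norm_nonneg _
  calc K' * (‖resL l τ t (y₀ + w₀ - (y₁ + w₁))‖ * (‖resL l τ t (y₀ + w₀ + (y₁ + w₁))‖ + 1))
      ≤ K' * ((ρ + η) * (4 * |R| + 2 + 1)) := by gcongr
    _ = K' * (4 * |R| + 3) * (ρ + η) := by ring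

theorem add_add_pow_four_le {x y z : ℝ} :
    (x + y + z) ^ 4 ≤ 27 * (x ^ 4 + y ^ 4 + z ^ 4) := by
  have h1 : (x + y + z) ^ 2 ≤ 3 * (x ^ 2 + y ^ 2 + z ^ 2) := by
    nlinarith [sq_nonneg (x - y), sq_nonneg (y - z), sq_nonneg (x - z)]
  have h2 : (x ^ 2 + y ^ 2 + z ^ 2) ^ 2 ≤ 3 * (x ^ 4 + y ^ 4 + z ^ 4) := by
    nlinarith [sq_nonneg (x ^ 2 - y ^ 2), sq_nonneg (y ^ 2 - z ^ 2), sq_nonneg (x ^ 2 - z ^ 2)]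
  have h3 := pow_le_pow_left₀ (sq_nonneg _) h1 2
  nlinarith

end

end KS

end

theorem lemma4p1 (b : KS.TestClass) (l c : ℝ) (hl : 0 < l) (hc : KS.StrictlyNegative b l c)
    (T R : ℝ) (hT : 0 < T) :
    ∃ C > 0, ∃ δ > 0, ∀ τ : ℝ, 0 < τ → τ ≤ T →
      ∀ (u₀ u₁ : KS.H l) (w₀ w₁ y₀ y₁ : KS.E l τ),
        KS.IsSolution b l c τ u₀ w₀ y₀ → KS.IsSolution b l c τ u₁ w₁ y₁ →
        ‖y₀‖ ≤ R → ‖w₀‖ ≤ R → ‖u₀ - u₁‖ + ‖w₀ - w₁‖ ≤ δ →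
          ‖y₀ - y₁‖ ≤ C * (‖u₀ - u₁‖ + ‖w₀ - w₁‖) ∧
          ∀ᵐ t ∂(MeasureTheory.volume.restrict (Set.Ioo 0 τ)),
            ‖y₀ t - y₁ t‖ ≤ C * (t ^ (-(1 / 16) : ℝ) * ‖u₀ - u₁‖ + ‖w₀ - w₁‖) := by
  obtain ⟨K, hK, L, hL, hsol⟩ := KS.exists_solution_sub_ae_le hl hc hT R
  set A : ℝ := 27 * (K ^ 4 * (T ^ ((3 / 4) : ℝ) / (3 / 4)) + L ^ 4 * T) with hA
  have hA0 : 0 < A := by positivity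
  set β : ℝ := 27 * L ^ 4 with hβ
  have hβ0 : 0 < β := by positivity
  set C₀ : ℝ := A * Real.exp (β * T) with hC₀
  have hC₀0 : 0 < C₀ := by positivity
  set C₁ : ℝ := 1 + C₀ with hC₁
  have hC₁0 : 0 < C₁ := by positivity
  -- With distance `ε` of the data, Gronwall gives `‖y₀ - y₁‖⁴ ≤ C₀ ε⁴`, and `ε ≤ 1 / (1 + C₀)` keeps
  -- this below `1`.
  refine ⟨C₁ + K + L * C₁ * T ^ ((1 / 16) : ℝ) + L * (C₁ + 1), by positivity, 1 / C₁,
    by positivity, ?_⟩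
  intro τ hτ hτT u₀ u₁ w₀ w₁ y₀ y₁ h₀ h₁ hy hw hδ
  set e := ‖u₀ - u₁‖ with he
  set η := ‖w₀ - w₁‖ with hη
  have he0 : 0 ≤ e := norm_nonneg _
  have hη0 : 0 ≤ η := norm_nonneg _
  have hδ1 : e + η ≤ 1 := hδ.trans (by rw [div_le_one hC₁0]; linarith)
  have hae := hsol τ hτ hτT u₀ u₁ w₀ w₁ y₀ y₁ h₀ h₁ hy hw (by linarith)
  set d := y₀ - y₁ with hd
  let φ : ℝ → ℝ := (Ioo 0 τ).indicator fun t => ‖d t‖ ^ 4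
  have hφ : Integrable φ :=
    (integrable_indicator_iff measurableSet_Ioo).2 (KS.integrable_norm_pow_four d)
  have hφ0 : ∀ t, 0 ≤ φ t := fun t => indicator_nonneg (fun s _ => by positivity) t
  have hD : ∀ t, 0 < t → t ≤ τ → ∫ s in (0 : ℝ)..t, φ s = ‖KS.resL l τ t d‖ ^ 4 := by
    intro t ht htτ
    rw [KS.norm_resL_pow_four htτ, intervalIntegral.integral_of_le ht.le,
      integral_Ioc_eq_integral_Ioo]
    refine setIntegral_congr_fun measurableSet_Ioo fun s hs => ?_
    exact indicator_of_mem (Ioo_subset_Ioo_right htτ hs) _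
  have hDτ : ∫ s in (0 : ℝ)..τ, φ s = ‖d‖ ^ 4 := by
    rw [hD τ hτ le_rfl, KS.norm_resL_pow_four le_rfl, KS.norm_pow_four]
  let α : ℝ → ℝ := fun t => 27 * (K ^ 4 * e ^ 4 * t ^ (-(1 / 4) : ℝ) + L ^ 4 * η ^ 4)
  have hαi : IntervalIntegrable (fun t : ℝ => t ^ (-(1 / 4) : ℝ)) volume 0 τ :=
    intervalIntegral.intervalIntegrable_rpow' (by norm_num)
  have hα : IntervalIntegrable α volume 0 τ :=
    ((hαi.const_mul _).add intervalIntegrable_const).const_mul _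
  have hαa : ∫ t in (0 : ℝ)..τ, α t ≤ A * (e + η) ^ 4 := by
    have h1 : ∫ t in (0 : ℝ)..τ, α t =
        27 * (K ^ 4 * e ^ 4 * (τ ^ ((3 / 4) : ℝ) / (3 / 4)) + L ^ 4 * η ^ 4 * τ) := by
      rw [intervalIntegral.integral_const_mul, intervalIntegral.integral_add (hαi.const_mul _)
        intervalIntegrable_const, intervalIntegral.integral_const_mul,
        integral_rpow (Or.inl (by norm_num)), intervalIntegral.integral_const]
      norm_num
      ring
    have h2 : e ^ 4 ≤ (e + η) ^ 4 := pow_le_pow_left₀ he0 (by linarith) 4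
    have h3 : η ^ 4 ≤ (e + η) ^ 4 := pow_le_pow_left₀ hη0 (by linarith) 4
    have h4 : τ ^ ((3 / 4) : ℝ) ≤ T ^ ((3 / 4) : ℝ) := Real.rpow_le_rpow hτ.le hτT (by norm_num)
    rw [h1]
    calc _ ≤ 27 * (K ^ 4 * (e + η) ^ 4 * (T ^ ((3 / 4) : ℝ) / (3 / 4)) +
          L ^ 4 * (e + η) ^ 4 * T) := by gcongr
      _ = _ := by rw [hA]; ring
  have hexp : A * (e + η) ^ 4 * Real.exp (β * τ) ≤ C₀ * (e + η) ^ 4 := by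
    have : Real.exp (β * τ) ≤ Real.exp (β * T) := by gcongr
    calc _ = A * Real.exp (β * τ) * (e + η) ^ 4 := by ring
      _ ≤ _ := by rw [hC₀]; gcongr
  have hsmall : A * (e + η) ^ 4 * Real.exp (β * τ) < 1 := by
    refine hexp.trans_lt ?_
    have h1 : (e + η) ^ 4 ≤ 1 / C₁ :=
      (pow_le_of_le_one (by linarith) hδ1 (by norm_num)).trans hδ
    calc C₀ * (e + η) ^ 4 ≤ C₀ * (1 / C₁) := by gcongr
      _ < 1 := by rw [mul_one_div, div_lt_one hC₁0]; linarith
  have hmain := KS.integral_le_of_le_one_imp (α := α) hφ hφ0 hτ.le hα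
    (fun t ht => by have := ht.1; positivity) hαa hβ0.le ?_ hsmall
  · rw [hDτ] at hmain
    have hle := hmain.trans hexp
    have hd1 : ‖d‖ ≤ C₁ * (e + η) := by
      refine le_of_pow_le_pow_left₀ (n := 4) (by norm_num) (by positivity) (hle.trans ?_)
      rw [mul_pow]
      gcongr
      have : C₁ ≤ C₁ ^ 4 := le_self_pow₀ (by linarith) (by norm_num)
      linarith
    have hdle1 : ‖d‖ ≤ 1 := by
      refine hd1.trans ?_
      calc C₁ * (e + η) ≤ C₁ * (1 / C₁) := by gcongr
        _ = 1 := by field_simp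
    refine ⟨hd1.trans ?_, ?_⟩
    · gcongr
      have : 0 ≤ L * C₁ * T ^ ((1 / 16) : ℝ) := by positivity
      have : 0 ≤ L * (C₁ + 1) := by positivity
      linarith
    · filter_upwards [hae, MeasureTheory.Lp.coeFn_sub y₀ y₁, ae_restrict_mem measurableSet_Ioo]
        with t a1 a2 ht
      have ht0 : 0 < t := ht.1
      have hρ : ‖KS.resL l τ t d‖ ≤ ‖d‖ := KS.norm_resL_le d
      have a3 := a1 (hρ.trans hdle1)
      rw [a2, Pi.sub_apply] at a3
      have hTt : 1 ≤ T ^ ((1 / 16) : ℝ) * t ^ (-(1 / 16) : ℝ) := by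
        rw [Real.rpow_neg ht0.le, ← div_eq_mul_inv, one_le_div (by positivity)]
        exact Real.rpow_le_rpow ht0.le (ht.2.le.trans hτT) (by norm_num)
      set p := t ^ (-(1 / 16) : ℝ) with hp
      have hp0 : 0 < p := by positivity
      have h5 : L * (‖KS.resL l τ t d‖ + η) ≤ L * (C₁ * (e + η) + η) := by
        gcongr
        exact hρ.trans hd1
      have h6 : L * C₁ * e ≤ L * C₁ * T ^ ((1 / 16) : ℝ) * (p * e) := by
        calc L * C₁ * e ≤ L * C₁ * e * (T ^ ((1 / 16) : ℝ) * p) :=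
              le_mul_of_one_le_right (by positivity) hTt
          _ = _ := by ring
      have g1 : 0 ≤ C₁ * (p * e) := by positivity
      have g2 : 0 ≤ L * (C₁ + 1) * (p * e) := by positivity
      have g3 : 0 ≤ C₁ * η := by positivity
      have g4 : 0 ≤ K * η := by positivity
      have g5 : 0 ≤ L * C₁ * T ^ ((1 / 16) : ℝ) * η := by positivity
      refine a3.trans ?_
      linarith
  · filter_upwards [hae, ae_restrict_mem measurableSet_Ioo] with t a1 ht h1
    have ht0 : 0 < t := ht.1
    rw [hD t ht0 ht.2.le] at h1 ⊢
    have hρ : ‖KS.resL l τ t d‖ ≤ 1 := (pow_le_one_iff_of_nonneg (norm_nonneg _) (by norm_num)).1 h1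
    have e2 : (t ^ (-(1 / 16) : ℝ)) ^ 4 = t ^ (-(1 / 4) : ℝ) := by
      rw [← Real.rpow_natCast, ← Real.rpow_mul ht0.le]
      norm_num
    have hφt : φ t = ‖d t‖ ^ 4 := indicator_of_mem ht _
    rw [hφt]
    have a2 : ‖d t‖ ≤ K * t ^ (-(1 / 16) : ℝ) * e + L * ‖KS.resL l τ t d‖ + L * η :=
      (a1 hρ).trans_eq (by ring)
    calc ‖d t‖ ^ 4 ≤ (K * t ^ (-(1 / 16) : ℝ) * e + L * ‖KS.resL l τ t d‖ + L * η) ^ 4 := by gcongr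
      _ ≤ 27 * ((K * t ^ (-(1 / 16) : ℝ) * e) ^ 4 + (L * ‖KS.resL l τ t d‖) ^ 4 +
          (L * η) ^ 4) := KS.add_add_pow_four_le
      _ = _ := by
        rw [mul_pow, mul_pow, e2]
        simp only [α, hβ]
        ring
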